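/- For a positive integer $N$ let $(g_{ij})_{1\le i<j\le N}$ and $(g_i)_{1\le i\le N}$ be i.i.d. standard Gaussian random variables, and for $\beta,\gamma,h\in\mathbb{R}$ and $\sigma\in\{-1,1\}^N$ put $$-H_N(\sigma)=\frac{\beta}{\sqrt N}\sum_{1\le i<j\le N}g_{ij}\sigma_i\sigma_j+h\sum_{i=1}^N\sigma_i+\gamma\sum_{i=1}^N g_i\sigma_i$$ (the Sherrington–Kirkpatrick model with a random external field). Let $G_N$ be the random probability measure on $\{-1,1\}^N$ with $G_N(\{\sigma\})\propto e^{-H_N(\sigma)}$. For a function $F$ of $k$ replicas $\sigma^1,\dots,\sigma^k\in\{-1,1\}^N$ let $$\langle F\rangle=\sum_{\sigma^1,\dots,\sigma^k}F(\sigma^1,\dots,\sigma^k)\,G_N(\{\sigma^1\})\cdots G_N(\{\sigma^k\}),\qquad \nu(F)=\mathbb{E}\langle F\rangle,$$ and let $R_{\ell,\ell'}=\frac1N\sum_{i=1}^N\sigma_i^\ell\sigma_i^{\ell'}$. Let $p_N(\beta,\gamma,h)=\mathbb{E}\,\frac1N\log\sum_{\sigma}e^{-H_N(\sigma)}$. Then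 the limit $p(\beta,\gamma,h)=\lim_{N\to\infty}p_N(\beta,\gamma,h)$ exists (and is finite) for all $\beta,\gamma,h\in\mathbb{R}$. Moreover, if $\gamma\neq0$ and $p$ is differentiable in $\gamma$ at the point $(\beta,\gamma,h)$, then the Ghirlanda–Guerra identities hold at $(\beta,\gamma,h)$: for every integer $n\ge1$ and every bounded measurable function $f:\mathbb{R}^{n(n-1)/2}\to\mathbb{R}$, writing $f=f\big((R_{\ell,\ell'})_{1\le\ell<\ell'\le n}\big)$, $$\lim_{N\to\infty}\Big[\nu(R_{1,n+1}f)-\frac1n\,\nu(R_{1,2})\,\nu(f)-\frac1n\sum_{2\le\ell\le n}\nu(R_{1,\ell}f)\Big]=0.$$ -/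

import Mathlib

open MeasureTheory ProbabilityTheory Filter Topology

namespace SK

/-- Spin configurations, i.e. elements of `{-1, 1}^N` (the units of `ℤ` are `1` and `-1`). -/
abbrev Config (N : ℕ) : Type := Fin N → ℤˣ

/-- The `i`-th spin of a configuration as a real number, `1` or `-1`. -/
def spin {N : ℕ} (σ : Config N) (i : Fin N) : ℝ := ((σ i : ℤ) : ℝ)

/-- Ordered pairs `i < j` of indices among `m` indices; there are `m (m - 1) / 2` of them. -/
abbrev Pairs (m : ℕ) : Type := {p : Fin m × Fin m // p.1 < p.2}

/-- A realization of the disorder: the couplings `g_{ij}` for `i < j` (left summand) together with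
the random fields `g_i` (right summand). -/
abbrev Disorder (N : ℕ) : Type := Pairs N ⊕ Fin N → ℝ

/-- The law of the disorder: all `g_{ij}` and `g_i` are i.i.d. standard Gaussian. -/
noncomputable def disorderLaw (N : ℕ) : Measure (Disorder N) :=
  Measure.pi fun _ => gaussianReal 0 1

/-- Minus the Hamiltonian, `-H_N(σ)`, for the disorder `g`. -/
noncomputable def negHamiltonian (β γ h : ℝ) {N : ℕ} (g : Disorder N) (σ : Config N) : ℝ :=
  β / √(N : ℝ) * ∑ p : Pairs N, g (Sum.inl p) * spin σ p.1.1 * spin σ p.1.2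
    + h * ∑ i, spin σ i
    + γ * ∑ i, g (Sum.inr i) * spin σ i

/-- The partition function `∑_σ exp (-H_N(σ))`. -/
noncomputable def partitionFunction (β γ h : ℝ) {N : ℕ} (g : Disorder N) : ℝ :=
  ∑ σ : Config N, Real.exp (negHamiltonian β γ h g σ)

/-- The mass `G_N({σ})` that the (random) Gibbs measure gives to `σ`. -/
noncomputable def gibbsMass (β γ h : ℝ) {N : ℕ} (g : Disorder N) (σ : Config N) : ℝ :=
  Real.exp (negHamiltonian β γ h g σ) / partitionFunction β γ h g

/-- The Gibbs average `⟨F⟩` of a function `F` of `k` replicas. -/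
noncomputable def gibbsAverage (β γ h : ℝ) {N k : ℕ} (g : Disorder N)
    (F : (Fin k → Config N) → ℝ) : ℝ :=
  ∑ s : Fin k → Config N, F s * ∏ l, gibbsMass β γ h g (s l)

/-- `ν(F) = 𝔼⟨F⟩` for a function `F` of `k` replicas. -/
noncomputable def nu (β γ h : ℝ) {N k : ℕ} (F : (Fin k → Config N) → ℝ) : ℝ :=
  ∫ g, gibbsAverage β γ h g F ∂(disorderLaw N)

/-- The overlap of two configurations. -/
noncomputable def overlap {N : ℕ} (σ τ : Config N) : ℝ :=
  1 / (N : ℝ) * ∑ i, spin σ i * spin τ i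

/-- The collection `(R_{l,l'})_{l < l'}` of all overlaps among `n` replicas. -/
noncomputable def overlaps {N n : ℕ} (s : Fin n → Config N) : Pairs n → ℝ :=
  fun p => overlap (s p.1.1) (s p.1.2)

/-- The free energy per particle `ψ_N = (1/N) log ∑_σ exp (-H_N(σ))`. -/
noncomputable def freeEnergy (β γ h : ℝ) {N : ℕ} (g : Disorder N) : ℝ :=
  1 / (N : ℝ) * Real.log (partitionFunction β γ h g)

/-- The expected free energy per particle `p_N(β, γ, h) = 𝔼 ψ_N`. -/
noncomputable def meanFreeEnergy (N : ℕ) (β γ h : ℝ) : ℝ :=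
  ∫ g, freeEnergy β γ h g ∂(disorderLaw N)

/-- `δ_N(β, γ, h) = ν(R_{1,n+1} f) - (1/n) ν(R_{1,2}) ν(f) - (1/n) ∑_{2 ≤ l ≤ n} ν(R_{1,l} f)`,
where `f` is evaluated at the overlaps of the first `n` replicas. Replicas are numbered from `0`:
the first replica is `0`, and replica `n + 1` is `Fin.last n`. -/
noncomputable def delta (n : ℕ) [NeZero n] (f : (Pairs n → ℝ) → ℝ) (N : ℕ) (β γ h : ℝ) : ℝ :=
  nu β γ h (fun s : Fin (n + 1) → Config N =>
      overlap (s 0) (s (Fin.last n)) * f (overlaps fun l : Fin n => s l.castSucc))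
    - 1 / (n : ℝ) * nu β γ h (fun s : Fin 2 → Config N => overlap (s 0) (s 1))
        * nu β γ h (fun s : Fin n → Config N => f (overlaps s))
    - 1 / (n : ℝ) * ∑ l ∈ Finset.Ioi (0 : Fin n),
        nu β γ h (fun s : Fin n → Config N => overlap (s 0) (s l) * f (overlaps s))

end SK

/-!
The limit of the free energy exists by Fekete's lemma. Superadditivity (`meanLog_add_le`) is the
interpolation of Guerra and Toninelli, phrased through a Gaussian comparison
(`integral_log_sumExp_mono`): the expected log-partition function increases with the variances of
the increments of the energy. For the Sherrington–Kirkpatrick energy these variances are, up to the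
contribution of the random field, `β² (N - (∑ σᵢ τᵢ)² / N)`, so that the hypothesis of the
comparison is the convexity inequality `(x + y)² / (m + k) ≤ x² / m + y² / k`.

For the identities, let `e(σ) = (1/N) ∑ gᵢ σᵢ` be the field energy, and let `d` be the derivative of
`p` in `γ`. Adding `N t e` to the energy replaces `γ` by `γ + t`, so the exponential moments of `e`
under the Gibbs measure are increments of the free energy. By Jensen's inequality this bounds the
Gibbs average of `|e - d|` by `log 2 / (N t)` plus `1 / t` times the two errors
`|ψ(γ ± t) - ψ(γ) ∓ t d|` (`avg_abs_fieldEnergy_sub_le`), where `ψ` is the random free energy. Since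
`ψ` concentrates (`integral_abs_freeEnergy_sub_le`, from a variance bound that sums the squared
Lipschitz constants of all coordinates), letting `N → ∞` and then `t → 0` gives `ν(|e - d|) → 0` at
every point of differentiability (`tendsto_fieldDeviation`), without averaging over `γ`.

Consequently `ν(e(σ¹) f) - ν(e) ν(f) → 0` for bounded `f`. Gaussian integration by parts in the
random field (`integral_gibbsAverage_mul_fieldEnergy`) turns this difference into `-n γ δ_N`, where
`δ_N` is the defect in the Ghirlanda–Guerra identity; as `γ ≠ 0`, it follows that `δ_N → 0`.
-/

namespace SK

/-! ### Gaussian measures on finite products -/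

/-- The standard Gaussian measure on `ℝ^ι`. -/
noncomputable abbrev gaussianPi (ι : Type*) [Fintype ι] : Measure (ι → ℝ) :=
  Measure.pi fun _ => gaussianReal 0 1

lemma integrable_id_stdGaussian : Integrable (fun x : ℝ => x) (gaussianReal 0 1) :=
  (memLp_id_gaussianReal 1).integrable le_rfl

lemma integral_sq_stdGaussian : ∫ x, x ^ 2 ∂gaussianReal 0 1 = 1 := by
  have h := variance_eq_integral (μ := gaussianReal 0 1) (X := fun x : ℝ => x) (by fun_prop)
  rw [variance_fun_id_gaussianReal] at h
  simpa using h.symm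

lemma integrable_sq_stdGaussian : Integrable (fun x : ℝ => x ^ 2) (gaussianReal 0 1) :=
  (memLp_id_gaussianReal 2).integrable_sq

/-- Gaussian integration by parts (Stein's lemma) in one dimension. -/
lemma integral_mul_stdGaussian {f f' : ℝ → ℝ} (hf : ∀ x, HasDerivAt f (f' x) x) {C C' : ℝ}
    (hC : ∀ x, |f x| ≤ C) (hC' : ∀ x, |f' x| ≤ C') :
    ∫ x, x * f x ∂gaussianReal 0 1 = ∫ x, f' x ∂gaussianReal 0 1 := by
  have hfm : Measurable f := (continuous_iff_continuousAt.2 fun x => (hf x).continuousAt).measurable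
  have hf'm : Measurable f' := by
    rw [← funext fun x => (hf x).deriv]; exact measurable_deriv f
  have hpdf : ∀ x : ℝ, HasDerivAt (gaussianPDFReal 0 1) (-x * gaussianPDFReal 0 1 x) x := by
    intro x
    have h1 : HasDerivAt (fun x : ℝ => -(x - 0) ^ 2 / (2 * ((1 : NNReal) : ℝ))) (-x) x := by
      have := ((((hasDerivAt_id x).sub_const 0).pow 2).neg).div_const (2 * ((1 : NNReal) : ℝ))
      refine this.congr_deriv ?_
      simp only [id, NNReal.coe_one, Nat.cast_ofNat]
      ring
    have := (h1.exp).const_mul (√(2 * Real.pi * ((1 : NNReal) : ℝ)))⁻¹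
    rw [gaussianPDFReal_def]
    refine this.congr_deriv ?_
    ring
  have hi1 : Integrable (fun x => f' x * gaussianPDFReal 0 1 x) :=
    (integrable_gaussianPDFReal 0 1).bdd_mul hf'm.aestronglyMeasurable
      (ae_of_all _ fun x => by simpa using hC' x)
  have hx : Integrable (fun x : ℝ => x * gaussianPDFReal 0 1 x) := by
    have := integrable_id_stdGaussian
    rw [gaussianReal_of_var_ne_zero 0 one_ne_zero,
      integrable_withDensity_iff (measurable_gaussianPDF 0 1)
        (ae_of_all _ fun x => gaussianPDF_lt_top)] at this
    simpa only [toReal_gaussianPDF] using this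
  have hi2 : Integrable (fun x => f x * (-x * gaussianPDFReal 0 1 x)) := by
    have := (hx.bdd_mul hfm.aestronglyMeasurable (ae_of_all _ fun x => by simpa using hC x)).neg
    refine this.congr (ae_of_all _ fun x => ?_)
    simp
  have hi3 : Integrable (fun x => f x * gaussianPDFReal 0 1 x) :=
    (integrable_gaussianPDFReal 0 1).bdd_mul hfm.aestronglyMeasurable
      (ae_of_all _ fun x => by simpa using hC x)
  have key := integral_mul_deriv_eq_deriv_mul_of_integrable (u := f) (v := gaussianPDFReal 0 1)
    (u' := f') (v' := fun x => -x * gaussianPDFReal 0 1 x) (fun x _ => hf x) (fun x _ => hpdf x)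
    hi2 hi1 hi3
  rw [integral_gaussianReal_eq_integral_smul one_ne_zero,
    integral_gaussianReal_eq_integral_smul one_ne_zero]
  simp only [smul_eq_mul]
  have e1 : ∫ x, gaussianPDFReal 0 1 x * (x * f x)
      = - ∫ x, f x * (-x * gaussianPDFReal 0 1 x) := by
    rw [← integral_neg]; congr 1; ext x; ring
  rw [e1, key, neg_neg]; congr 1; ext x; ring

section pi
variable {ι : Type*} [Fintype ι]

lemma integrable_eval (i : ι) : Integrable (fun g : ι → ℝ => g i) (gaussianPi ι) :=
  (measurePreserving_eval (fun _ : ι => gaussianReal 0 1) i).integrable_comp_of_integrable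
    integrable_id_stdGaussian

lemma memLp_eval (i : ι) : MemLp (fun g : ι → ℝ => g i) 2 (gaussianPi ι) :=
  (memLp_id_gaussianReal 2).comp_measurePreserving
    (measurePreserving_eval (fun _ : ι => gaussianReal 0 1) i)

/-- Resampling one coordinate of a Gaussian vector does not change its law. -/
lemma measurePreserving_update [DecidableEq ι] (i : ι) :
    MeasurePreserving (fun q : (ι → ℝ) × ℝ => Function.update q.1 i q.2)
      ((gaussianPi ι).prod (gaussianReal 0 1)) (gaussianPi ι) := by
  have hm : Measurable fun q : (ι → ℝ) × ℝ => Function.update q.1 i q.2 := by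
    rw [measurable_pi_iff]
    intro j
    by_cases h : j = i
    · subst h; simpa using measurable_snd
    · simp only [Function.update_of_ne h]; fun_prop
  refine ⟨hm, (Measure.pi_eq fun s hs => ?_).symm⟩
  rw [Measure.map_apply hm (MeasurableSet.univ_pi hs)]
  have : (fun q : (ι → ℝ) × ℝ => Function.update q.1 i q.2) ⁻¹' (Set.univ.pi s)
      = (Set.univ.pi (Function.update s i Set.univ)) ×ˢ s i := by
    ext q
    simp only [Set.mem_preimage, Set.mem_pi, Set.mem_univ, forall_true_left, Set.mem_prod]
    constructor
    · intro h
      refine ⟨fun j => ?_, by simpa using h i⟩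
      by_cases hj : j = i
      · subst hj; simp
      · simpa [hj] using h j
    · rintro ⟨h1, h2⟩ j
      by_cases hj : j = i
      · subst hj; simpa using h2
      · simpa [hj] using h1 j
  rw [this, Measure.prod_prod, Measure.pi_pi, ← Finset.mul_prod_erase _ _ (Finset.mem_univ i),
    ← Finset.mul_prod_erase Finset.univ (fun j => gaussianReal 0 1 (s j)) (Finset.mem_univ i)]
  simp only [Function.update_self, measure_univ, one_mul]
  rw [mul_comm]
  congr 1
  refine Finset.prod_congr rfl fun j hj => ?_
  rw [Function.update_of_ne (Finset.ne_of_mem_erase hj)]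

/-- Gaussian integration by parts (Stein's lemma) in the coordinate `i`. -/
lemma integral_eval_mul [DecidableEq ι] (i : ι) {F F' : (ι → ℝ) → ℝ}
    (hF : Measurable F) (hF' : Measurable F')
    (hd : ∀ g x, HasDerivAt (fun y => F (Function.update g i y)) (F' (Function.update g i x)) x)
    {C C' : ℝ} (hC : ∀ g, |F g| ≤ C) (hC' : ∀ g, |F' g| ≤ C') :
    ∫ g, g i * F g ∂gaussianPi ι = ∫ g, F' g ∂gaussianPi ι := by
  have hmp := measurePreserving_update (ι := ι) i
  have hI : Integrable (fun g : ι → ℝ => g i * F g) (gaussianPi ι) :=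
    (integrable_eval i).mul_bdd (c := C) hF.aestronglyMeasurable (ae_of_all _ hC)
  have hI' : Integrable F' (gaussianPi ι) :=
    Integrable.of_bound hF'.aestronglyMeasurable C' (ae_of_all _ hC')
  have hres : ∀ k : (ι → ℝ) → ℝ, Integrable k (gaussianPi ι) → ∫ g, k g ∂gaussianPi ι
      = ∫ g, ∫ x, k (Function.update g i x) ∂gaussianReal 0 1 ∂gaussianPi ι := by
    intro k hk
    have h1 := integral_map hmp.aemeasurable (f := k) (by
      rw [hmp.map_eq]; exact hk.aestronglyMeasurable)
    rw [hmp.map_eq] at h1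
    rw [h1]
    exact integral_prod _ (hmp.integrable_comp_of_integrable hk)
  rw [hres _ hI, hres _ hI']
  congr 1
  ext g
  simp only [Function.update_self]
  exact integral_mul_stdGaussian (hd g) (fun x => hC _) (fun x => hC' _)

/-- A function which is Lipschitz for a weighted `ℓ¹` distance is square integrable under the
Gaussian measure. -/
lemma memLp_two_of_lipschitz {f : (ι → ℝ) → ℝ} {c : ι → ℝ}
    (hf : ∀ x y, |f x - f y| ≤ ∑ i, c i * |x i - y i|) : MemLp f 2 (gaussianPi ι) := by
  have hcont : Continuous f := by
    rw [continuous_iff_continuousAt]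
    intro x
    have h0 : Tendsto (fun y : ι → ℝ => ∑ i, c i * |y i - x i|) (𝓝 x) (𝓝 0) := by
      have : Continuous fun y : ι → ℝ => ∑ i, c i * |y i - x i| := by fun_prop
      simpa using this.tendsto x
    exact tendsto_iff_dist_tendsto_zero.2
      (squeeze_zero (fun _ => dist_nonneg) (fun y => hf y x) h0)
  have hi : ∀ i ∈ Finset.univ, MemLp (fun g : ι → ℝ => c i * |g i|) 2 (gaussianPi ι) :=
    fun i _ => (memLp_eval i).norm.const_mul (c i)
  have hb : MemLp (fun g : ι → ℝ => |f 0| + ∑ i, c i * |g i|) 2 (gaussianPi ι) :=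
    (memLp_const |f 0|).add (memLp_finsetSum Finset.univ hi)
  refine hb.mono hcont.aestronglyMeasurable (ae_of_all _ fun g => ?_)
  have h1 := hf g 0
  simp only [Pi.zero_apply, sub_zero] at h1
  rw [Real.norm_eq_abs, Real.norm_eq_abs]
  refine le_trans ?_ (le_abs_self _)
  have := abs_sub_abs_le_abs_sub (f g) (f 0)
  linarith

end pi

/-- The variance bound of Efron–Stein type on `ℝ^n`: each coordinate contributes the square of its
Lipschitz constant. -/
lemma variance_le_of_lipschitz_fin : ∀ (n : ℕ) {f : (Fin n → ℝ) → ℝ} {c : Fin n → ℝ},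
    (∀ x y, |f x - f y| ≤ ∑ i, c i * |x i - y i|) →
    Var[f; gaussianPi (Fin n)] ≤ ∑ i, c i ^ 2 := by
  intro n
  induction n with
  | zero =>
    intro f c hf
    have : f = fun _ => f 0 := by ext x; rw [Subsingleton.elim x 0]
    rw [this, variance_eq_sub (memLp_const _)]
    simp
  | succ n ih =>
    intro f c hf
    set μ := gaussianReal 0 1
    set ν := gaussianPi (Fin n)
    have hf2 := memLp_two_of_lipschitz hf
    have hmp := (measurePreserving_piFinSuccAbove (fun _ : Fin (n + 1) => μ) 0).symm
    have hcons : ∀ q : ℝ × (Fin n → ℝ),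
        (MeasurableEquiv.piFinSuccAbove (fun _ : Fin (n + 1) => ℝ) 0).symm q
          = Fin.cons q.1 q.2 := fun q => by
      simp [MeasurableEquiv.piFinSuccAbove, Fin.insertNthEquiv]
    let k : ℝ × (Fin n → ℝ) → ℝ := fun q => f (Fin.cons q.1 q.2)
    have hk : k = f ∘ (MeasurableEquiv.piFinSuccAbove (fun _ : Fin (n + 1) => ℝ) 0).symm := by
      ext q; simp only [k, Function.comp_apply, hcons]
    have hk2 : MemLp k 2 (μ.prod ν) := hk ▸ hf2.comp_measurePreserving hmp
    have hvar : Var[f; gaussianPi (Fin (n + 1))] = Var[k; μ.prod ν] := by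
      rw [hk]
      exact (hmp.variance_fun_comp hf2.aestronglyMeasurable.aemeasurable).symm
    have hlip : ∀ x x' y y', |k (x, y) - k (x', y')|
        ≤ c 0 * |x - x'| + ∑ i, c i.succ * |y i - y' i| := by
      intro x x' y y'
      simpa [Fin.sum_univ_succ] using hf (Fin.cons x y) (Fin.cons x' y')
    have hsec : ∀ y, MemLp (fun x => k (x, y)) 2 μ := by
      intro y
      have h := memLp_two_of_lipschitz (ι := Fin 1) (f := fun x => k (x 0, y))
        (c := fun _ => c 0) (fun x x' => by simpa using hlip (x 0) (x' 0) y y)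
      have := h.comp_measurePreserving
        (measurePreserving_funUnique μ (Fin 1)).symm
      exact this
    let F : (Fin n → ℝ) → ℝ := fun y => ∫ x, k (x, y) ∂μ
    have hF : ∀ y y', |F y - F y'| ≤ ∑ i, c i.succ * |y i - y' i| := by
      intro y y'
      have hi := fun y => (hsec y).integrable (by norm_num)
      simp only [F]
      rw [← integral_sub (hi y) (hi y')]
      have := norm_integral_le_of_norm_le_const (μ := μ) (f := fun x => k (x, y) - k (x, y'))
        (C := ∑ i, c i.succ * |y i - y' i|) (ae_of_all _ fun x => by
          simpa using hlip x x y y')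
      simpa using this
    have hF2 := memLp_two_of_lipschitz hF
    have hEF : ∫ y, F y ∂ν = ∫ q, k q ∂(μ.prod ν) :=
      (integral_prod_symm k (hk2.integrable (by norm_num))).symm
    -- The first coordinate contributes at most `c 0 ^ 2`; its average `F` keeps the other constants.
    have hsq : ∀ y, ∫ x, k (x, y) ^ 2 ∂μ ≤ F y ^ 2 + c 0 ^ 2 := by
      intro y
      have h1 : Var[fun x => k (x, y); μ] ≤ c 0 ^ 2 := by
        rw [← variance_sub_const (hsec y).aestronglyMeasurable (k (0, y))]
        refine (variance_le_expectation_sq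
          ((hsec y).aestronglyMeasurable.sub aestronglyMeasurable_const)).trans ?_
        calc ∫ x, (k (x, y) - k (0, y)) ^ 2 ∂μ ≤ ∫ x, c 0 ^ 2 * x ^ 2 ∂μ := by
              refine integral_mono ((hsec y).sub (memLp_const _)).integrable_sq
                (integrable_sq_stdGaussian.const_mul _) fun x => ?_
              have := hlip x 0 y y
              simp only [sub_zero, sub_self, abs_zero, mul_zero, Finset.sum_const_zero,
                add_zero] at this
              calc (k (x, y) - k (0, y)) ^ 2 = |k (x, y) - k (0, y)| ^ 2 := (sq_abs _).symm
                _ ≤ (c 0 * |x|) ^ 2 := by gcongr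
                _ = c 0 ^ 2 * x ^ 2 := by rw [mul_pow, sq_abs]
          _ = c 0 ^ 2 := by rw [integral_const_mul, integral_sq_stdGaussian, mul_one]
      rw [variance_eq_sub (hsec y)] at h1
      simp only [Pi.pow_apply] at h1
      linarith
    rw [hvar, variance_eq_sub hk2, ← hEF]
    have hvF := ih hF
    rw [variance_eq_sub hF2] at hvF
    simp only [Pi.pow_apply] at hvF ⊢
    rw [integral_prod_symm _ hk2.integrable_sq, Fin.sum_univ_succ]
    have : ∫ y, ∫ x, k (x, y) ^ 2 ∂μ ∂ν ≤ ∫ y, (F y ^ 2 + c 0 ^ 2) ∂ν :=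
      integral_mono hk2.integrable_sq.integral_prod_right
        (hF2.integrable_sq.add (integrable_const _)) hsq
    rw [integral_add hF2.integrable_sq (integrable_const _)] at this
    simp only [integral_const, probReal_univ, one_smul] at this
    linarith

/-- The variance bound of Efron–Stein type for the Gaussian measure on `ℝ^ι`. -/
lemma variance_le_of_lipschitz {ι : Type*} [Fintype ι] {f : (ι → ℝ) → ℝ} {c : ι → ℝ}
    (hf : ∀ x y, |f x - f y| ≤ ∑ i, c i * |x i - y i|) :
    Var[f; gaussianPi ι] ≤ ∑ i, c i ^ 2 := by
  classical
  let e := (Fintype.equivFin ι).symm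
  have hmp := measurePreserving_piCongrLeft (fun _ : ι => gaussianReal 0 1) e
  have happ : ∀ (x : Fin (Fintype.card ι) → ℝ) (j : Fin (Fintype.card ι)),
      MeasurableEquiv.piCongrLeft (fun _ : ι => ℝ) e x (e j) = x j := fun x j =>
    MeasurableEquiv.piCongrLeft_apply_apply (β := fun _ : ι => ℝ) e x j
  have h := variance_le_of_lipschitz_fin _
    (f := f ∘ MeasurableEquiv.piCongrLeft (fun _ : ι => ℝ) e) (c := c ∘ e) (fun x y => by
      refine (hf _ _).trans_eq ?_
      rw [← e.sum_comp]
      simp only [happ, Function.comp_apply])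
  have hv := hmp.variance_fun_comp (memLp_two_of_lipschitz hf).aestronglyMeasurable.aemeasurable
  refine hv.symm.trans_le (h.trans_eq ?_)
  exact e.sum_comp fun i => c i ^ 2

/-! ### Finite Gibbs measures with Gaussian energies -/

section finite
variable {S : Type*} [Fintype S]

/-- The partition function of an energy (with the sign convention of `negHamiltonian`) on a finite
set of states. -/
noncomputable def sumExp (E : S → ℝ) : ℝ := ∑ s, Real.exp (E s)

/-- The Gibbs probability of the state `s`. -/
noncomputable def prob (E : S → ℝ) (s : S) : ℝ := Real.exp (E s) / sumExp E

/-- The average of `F` under the Gibbs measure with energy `E`. -/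
noncomputable def avg (E F : S → ℝ) : ℝ := ∑ s, F s * prob E s

lemma avg_add (E F G : S → ℝ) : avg E (fun s => F s + G s) = avg E F + avg E G := by
  simp [avg, add_mul, Finset.sum_add_distrib]

lemma avg_sub (E F G : S → ℝ) : avg E (fun s => F s - G s) = avg E F - avg E G := by
  simp [avg, sub_mul, Finset.sum_sub_distrib]

lemma avg_const_mul (E F : S → ℝ) (r : ℝ) : avg E (fun s => r * F s) = r * avg E F := by
  simp [avg, mul_assoc, Finset.mul_sum]

lemma avg_sum {ι : Type*} (t : Finset ι) (E : S → ℝ) (F : ι → S → ℝ) :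
    avg E (fun s => ∑ i ∈ t, F i s) = ∑ i ∈ t, avg E (F i) := by
  simp only [avg, Finset.sum_mul]
  exact Finset.sum_comm

lemma avg_eq_div (E F : S → ℝ) : avg E F = (∑ s, F s * Real.exp (E s)) / sumExp E := by
  simp [avg, prob, Finset.sum_div, mul_div_assoc]

/-- Shifting the energy by `T` changes the partition function by the exponential moment of `T`. -/
lemma avg_exp (E T : S → ℝ) :
    avg E (fun s => Real.exp (T s)) = sumExp (fun s => E s + T s) / sumExp E := by
  rw [avg_eq_div]
  congr 1
  exact Finset.sum_congr rfl fun s _ => by rw [Real.exp_add, mul_comm]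

lemma hasDerivAt_sumExp_mul (F : S → ℝ) {E : ℝ → S → ℝ} {E' : S → ℝ} {t : ℝ}
    (h : ∀ s, HasDerivAt (fun x => E x s) (E' s) t) :
    HasDerivAt (fun x => ∑ s, F s * Real.exp (E x s)) (∑ s, F s * E' s * Real.exp (E t s)) t := by
  refine (HasDerivAt.fun_sum fun s _ => ((h s).exp).const_mul (F s)).congr_deriv ?_
  exact Finset.sum_congr rfl fun s _ => by ring

variable [Nonempty S]

lemma sumExp_pos (E : S → ℝ) : 0 < sumExp E :=
  Finset.sum_pos (fun _ _ => Real.exp_pos _) Finset.univ_nonempty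

lemma prob_nonneg (E : S → ℝ) (s : S) : 0 ≤ prob E s :=
  div_nonneg (Real.exp_pos _).le (sumExp_pos E).le

lemma sum_prob (E : S → ℝ) : ∑ s, prob E s = 1 := by
  simp only [prob, ← Finset.sum_div]
  exact div_self (sumExp_pos E).ne'

lemma avg_const (E : S → ℝ) (r : ℝ) : avg E (fun _ => r) = r := by
  simp [avg, ← Finset.mul_sum, sum_prob]

lemma avg_mono (E : S → ℝ) {F G : S → ℝ} (h : ∀ s, F s ≤ G s) : avg E F ≤ avg E G :=
  Finset.sum_le_sum fun s _ => mul_le_mul_of_nonneg_right (h s) (prob_nonneg E s)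

lemma abs_avg_le_avg_abs (E F : S → ℝ) : |avg E F| ≤ avg E fun s => |F s| := by
  refine (Finset.abs_sum_le_sum_abs _ _).trans_eq (Finset.sum_congr rfl fun s _ => ?_)
  rw [abs_mul, abs_of_nonneg (prob_nonneg E s)]

lemma abs_avg_le (E : S → ℝ) {F : S → ℝ} {C : ℝ} (h : ∀ s, |F s| ≤ C) : |avg E F| ≤ C :=
  (abs_avg_le_avg_abs E F).trans ((avg_mono E h).trans_eq (avg_const E C))

/-- The Gibbs covariance, symmetrized over two replicas. -/
lemma avg_mul_sub (E F G : S → ℝ) :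
    avg E (fun s => F s * G s) - avg E F * avg E G
      = 1 / 2 * ∑ s, ∑ s', prob E s * prob E s' * ((F s - F s') * (G s - G s')) := by
  have e : ∀ s s', prob E s * prob E s' * ((F s - F s') * (G s - G s'))
      = (F s * G s * prob E s) * prob E s' + prob E s * (F s' * G s' * prob E s')
        - (F s * prob E s) * (G s' * prob E s') - (G s * prob E s) * (F s' * prob E s') := by
    intro s s'; ring
  simp only [e, Finset.sum_sub_distrib, Finset.sum_add_distrib, ← Finset.mul_sum,
    ← Finset.sum_mul, sum_prob, avg]
  ring

lemma log_sumExp_le {E E' : S → ℝ} {C : ℝ} (h : ∀ s, E s ≤ E' s + C) :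
    Real.log (sumExp E) ≤ Real.log (sumExp E') + C := by
  rw [← Real.log_exp C, ← Real.log_mul (sumExp_pos E').ne' (Real.exp_pos _).ne']
  refine Real.log_le_log (sumExp_pos E) ?_
  rw [sumExp, sumExp, Finset.sum_mul]
  refine Finset.sum_le_sum fun s _ => ?_
  rw [← Real.exp_add]
  exact Real.exp_le_exp.2 (h s)

lemma abs_log_sumExp_sub_le {E E' : S → ℝ} {C : ℝ} (h : ∀ s, |E s - E' s| ≤ C) :
    |Real.log (sumExp E) - Real.log (sumExp E')| ≤ C := by
  rw [abs_le]
  constructor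
  · have := log_sumExp_le (E := E') (E' := E) (C := C) fun s => by
      have := (abs_le.1 (h s)).1; linarith
    linarith
  · have := log_sumExp_le (E := E) (E' := E') (C := C) fun s => by
      have := (abs_le.1 (h s)).2; linarith
    linarith

lemma hasDerivAt_log_sumExp {E : ℝ → S → ℝ} {E' : S → ℝ} {t : ℝ}
    (h : ∀ s, HasDerivAt (fun x => E x s) (E' s) t) :
    HasDerivAt (fun x => Real.log (sumExp (E x))) (avg (E t) E') t := by
  have h1 := hasDerivAt_sumExp_mul (fun _ => 1) h
  simp only [one_mul] at h1
  rw [avg_eq_div]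
  exact h1.log (sumExp_pos (E t)).ne'

lemma hasDerivAt_avg (F : S → ℝ) {E : ℝ → S → ℝ} {E' : S → ℝ} {t : ℝ}
    (h : ∀ s, HasDerivAt (fun x => E x s) (E' s) t) :
    HasDerivAt (fun x => avg (E x) F)
      (avg (E t) (fun s => F s * E' s) - avg (E t) F * avg (E t) E') t := by
  have h1 := hasDerivAt_sumExp_mul (fun _ => 1) h
  simp only [one_mul] at h1
  have h2 := (hasDerivAt_sumExp_mul F h).fun_div h1 (sumExp_pos (E t)).ne'
  simp only [avg_eq_div]
  refine h2.congr_deriv ?_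
  have := (sumExp_pos (E t)).ne'
  change (_ * sumExp (E t) - _) / sumExp (E t) ^ 2 = _
  field_simp

end finite

section gaussian

/-- An energy that is affine in the Gaussian disorder `g`. -/
def energy {S ι : Type*} [Fintype ι] (a : S → ι → ℝ) (c : S → ℝ) (g : ι → ℝ) (s : S) : ℝ :=
  c s + ∑ i, a s i * g i

lemma hasDerivAt_energy_update {S ι : Type*} [Fintype ι] [DecidableEq ι] (a : S → ι → ℝ)
    (c : S → ℝ) (g : ι → ℝ) (j : ι) (s : S) (x : ℝ) :
    HasDerivAt (fun y => energy a c (Function.update g j y) s) (a s j) x := by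
  have : ∀ y, energy a c (Function.update g j y) s
      = a s j * y + (c s + ∑ i ∈ Finset.univ.erase j, a s i * g i) := by
    intro y
    rw [energy, ← Finset.add_sum_erase _ _ (Finset.mem_univ j), Function.update_self,
      Finset.sum_congr rfl fun i hi => by
        rw [Function.update_of_ne (Finset.ne_of_mem_erase hi)]]
    ring
  simp only [this]
  simpa using ((hasDerivAt_id x).const_mul (a s j)).add_const
    (c s + ∑ i ∈ Finset.univ.erase j, a s i * g i)

lemma abs_le_sum_abs {S ι : Type*} [Fintype S] (a : S → ι → ℝ) (s : S) (i : ι) :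
    |a s i| ≤ ∑ s, |a s i| :=
  Finset.single_le_sum (f := fun s => |a s i|) (fun _ _ => abs_nonneg _) (Finset.mem_univ s)

variable {S ι κ : Type*} [Fintype S] [Fintype ι] [Fintype κ]

lemma measurable_sumExp_energy (a : S → ι → ℝ) (c : S → ℝ) :
    Measurable fun g => sumExp (energy a c g) := by
  unfold sumExp energy; fun_prop

lemma measurable_avg_energy (a : S → ι → ℝ) (c F : S → ℝ) :
    Measurable fun g => avg (energy a c g) F := by
  unfold avg prob
  have := measurable_sumExp_energy a c
  have h2 : ∀ s, Measurable fun g => Real.exp (energy a c g s) := by unfold energy; fun_prop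
  exact Finset.measurable_sum _ fun s _ => ((h2 s).div this).const_mul _

variable [Nonempty S]

lemma abs_log_sumExp_energy_sub_le {a : S → ι → ℝ} {c : S → ℝ} {A : ι → ℝ}
    (hA : ∀ s i, |a s i| ≤ A i) (g g' : ι → ℝ) :
    |Real.log (sumExp (energy a c g)) - Real.log (sumExp (energy a c g'))|
      ≤ ∑ i, A i * |g i - g' i| := by
  refine abs_log_sumExp_sub_le fun s => ?_
  simp only [energy, add_sub_add_left_eq_sub, ← Finset.sum_sub_distrib, ← mul_sub]
  refine (Finset.abs_sum_le_sum_abs _ _).trans (Finset.sum_le_sum fun i _ => ?_)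
  rw [abs_mul]
  exact mul_le_mul_of_nonneg_right (hA s i) (abs_nonneg _)

lemma memLp_log_sumExp_energy (a : S → ι → ℝ) (c : S → ℝ) :
    MemLp (fun g => Real.log (sumExp (energy a c g))) 2 (gaussianPi ι) :=
  memLp_two_of_lipschitz fun g g' => abs_log_sumExp_energy_sub_le (abs_le_sum_abs a) g g'

lemma integrable_log_sumExp_energy (a : S → ι → ℝ) (c : S → ℝ) :
    Integrable (fun g => Real.log (sumExp (energy a c g))) (gaussianPi ι) :=
  (memLp_log_sumExp_energy a c).integrable (by norm_num)

lemma abs_avg_le_sum (E F : S → ℝ) : |avg E F| ≤ ∑ s, |F s| :=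
  abs_avg_le _ fun s =>
    Finset.single_le_sum (f := fun s => |F s|) (fun _ _ => abs_nonneg _) (Finset.mem_univ s)

lemma integrable_avg_energy (a : S → ι → ℝ) (c F : S → ℝ) :
    Integrable (fun g => avg (energy a c g) F) (gaussianPi ι) :=
  Integrable.of_bound (measurable_avg_energy a c F).aestronglyMeasurable (∑ s, |F s|)
    (ae_of_all _ fun _ => abs_avg_le_sum _ _)

lemma integrable_avg_mul_avg (a : S → ι → ℝ) (c F G : S → ℝ) :
    Integrable (fun g => avg (energy a c g) F * avg (energy a c g) G) (gaussianPi ι) :=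
  (integrable_avg_energy a c G).bdd_mul (c := ∑ s, |F s|)
    (measurable_avg_energy a c F).aestronglyMeasurable (ae_of_all _ fun _ => abs_avg_le_sum _ _)

lemma integrable_eval_mul_avg (a : S → ι → ℝ) (c F : S → ℝ) (i : ι) :
    Integrable (fun g => g i * avg (energy a c g) F) (gaussianPi ι) :=
  (integrable_eval i).mul_bdd (c := ∑ s, |F s|) (measurable_avg_energy a c F).aestronglyMeasurable
    (ae_of_all _ fun _ => abs_avg_le_sum _ _)

/-- Gaussian integration by parts for a Gibbs average. -/
lemma integral_eval_mul_avg (a : S → ι → ℝ) (c F : S → ℝ) (j : ι) :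
    ∫ g, g j * avg (energy a c g) F ∂gaussianPi ι
      = ∫ g, (avg (energy a c g) (fun s => F s * a s j)
          - avg (energy a c g) F * avg (energy a c g) fun s => a s j) ∂gaussianPi ι := by
  classical
  refine integral_eval_mul j (measurable_avg_energy a c F)
    ((measurable_avg_energy a c _).sub
      ((measurable_avg_energy a c F).mul (measurable_avg_energy a c _)))
    (fun g x => hasDerivAt_avg F fun s => hasDerivAt_energy_update a c g j s x)
    (C := ∑ s, |F s|) (C' := (∑ s, |F s * a s j|) + (∑ s, |F s|) * ∑ s, |a s j|)
    (fun g => abs_avg_le_sum _ _) fun g => ?_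
  refine (abs_sub _ _).trans (add_le_add (abs_avg_le_sum _ _) ?_)
  rw [abs_mul]
  exact mul_le_mul (abs_avg_le_sum _ _) (abs_avg_le_sum _ _) (abs_nonneg _)
    (Finset.sum_nonneg fun _ _ => abs_nonneg _)

/-- Gaussian integration by parts for the Gibbs average of a function that is linear in the
disorder. -/
lemma integral_avg_sum_mul_eval (a u : S → ι → ℝ) (c : S → ℝ) :
    ∫ g, avg (energy a c g) (fun s => ∑ i, u s i * g i) ∂gaussianPi ι
      = ∫ g, ∑ i, (avg (energy a c g) (fun s => u s i * a s i)
          - avg (energy a c g) (fun s => u s i) * avg (energy a c g) fun s => a s i)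
        ∂gaussianPi ι := by
  have e : ∀ g, avg (energy a c g) (fun s => ∑ i, u s i * g i)
      = ∑ i, g i * avg (energy a c g) fun s => u s i := by
    intro g
    rw [avg_sum]
    simp only [← avg_const_mul, mul_comm]
  simp only [e]
  rw [integral_finsetSum, integral_finsetSum]
  · exact Finset.sum_congr rfl fun i _ => integral_eval_mul_avg a c _ i
  · intro i _
    exact (integrable_avg_energy a c _).sub (integrable_avg_mul_avg a c _ _)
  · intro i _
    exact integrable_eval_mul_avg a c _ i

end gaussian

/-! ### Gaussian comparison of free energies -/

section comparison
variable {S ι κ : Type*} [Fintype S] [Nonempty S] [Fintype ι] [Fintype κ]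

lemma measurePreserving_comp_inl {ι κ : Type*} [Fintype ι] [Fintype κ] :
    MeasurePreserving (fun g : ι ⊕ κ → ℝ => g ∘ Sum.inl) (gaussianPi (ι ⊕ κ)) (gaussianPi ι) :=
  measurePreserving_fst.comp
    (measurePreserving_sumPiEquivProdPi (X := fun _ : ι ⊕ κ => ℝ) fun _ => gaussianReal 0 1)

lemma measurePreserving_comp_inr {ι κ : Type*} [Fintype ι] [Fintype κ] :
    MeasurePreserving (fun g : ι ⊕ κ → ℝ => g ∘ Sum.inr) (gaussianPi (ι ⊕ κ)) (gaussianPi κ) :=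
  measurePreserving_snd.comp
    (measurePreserving_sumPiEquivProdPi (X := fun _ : ι ⊕ κ => ℝ) fun _ => gaussianReal 0 1)

lemma integral_log_sumExp_comp_inl (a : S → ι → ℝ) (c : S → ℝ) :
    ∫ g, Real.log (sumExp (energy a c (g ∘ Sum.inl))) ∂gaussianPi (ι ⊕ κ)
      = ∫ g, Real.log (sumExp (energy a c g)) ∂gaussianPi ι := by
  have hmp := measurePreserving_comp_inl (ι := ι) (κ := κ)
  have := integral_map hmp.aemeasurable (f := fun g => Real.log (sumExp (energy a c g)))
    (by rw [hmp.map_eq]; exact (integrable_log_sumExp_energy a c).aestronglyMeasurable)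
  rw [hmp.map_eq] at this
  exact this.symm

lemma integral_log_sumExp_comp_inr (a : S → κ → ℝ) (c : S → ℝ) :
    ∫ g, Real.log (sumExp (energy a c (g ∘ Sum.inr))) ∂gaussianPi (ι ⊕ κ)
      = ∫ g, Real.log (sumExp (energy a c g)) ∂gaussianPi κ := by
  have hmp := measurePreserving_comp_inr (ι := ι) (κ := κ)
  have := integral_map hmp.aemeasurable (f := fun g => Real.log (sumExp (energy a c g)))
    (by rw [hmp.map_eq]; exact (integrable_log_sumExp_energy a c).aestronglyMeasurable)
  rw [hmp.map_eq] at this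
  exact this.symm

/-- The interpolation, at angle `θ`, between two Gaussian families with independent disorders on
`ι` and `κ`. Its derivative in `θ` is its value at `θ + π / 2`. -/
noncomputable def interp {S ι κ : Type*} (a : S → ι → ℝ) (b : S → κ → ℝ) (θ : ℝ) (s : S) :
    ι ⊕ κ → ℝ :=
  Sum.elim (fun i => Real.sin θ * a s i) fun j => Real.cos θ * b s j

/-- Differentiation of the interpolated free energy under the expectation, dominated by a multiple
of `∑ |g k|`. -/
lemma hasDerivAt_integral_interp (a : S → ι → ℝ) (b : S → κ → ℝ) (c : S → ℝ) (θ : ℝ) :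
    HasDerivAt (fun θ => ∫ g, Real.log (sumExp (energy (interp a b θ) c g)) ∂gaussianPi (ι ⊕ κ))
      (∫ g, avg (energy (interp a b θ) c g)
        (fun s => ∑ k, interp a b (θ + Real.pi / 2) s k * g k) ∂gaussianPi (ι ⊕ κ)) θ := by
  have hd : ∀ (g : ι ⊕ κ → ℝ) (x : ℝ) (s : S), HasDerivAt (fun y => energy (interp a b y) c g s)
      (∑ k, interp a b (x + Real.pi / 2) s k * g k) x := by
    intro g x s
    refine (HasDerivAt.fun_sum fun k _ => ?_).const_add (c s)
    refine HasDerivAt.mul_const ?_ _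
    rcases k with i | j
    · simpa [interp, Real.sin_add_pi_div_two] using (Real.hasDerivAt_sin x).mul_const (a s i)
    · simpa [interp, Real.cos_add_pi_div_two] using (Real.hasDerivAt_cos x).mul_const (b s j)
  let A : ι ⊕ κ → ℝ := Sum.elim (fun i => ∑ s, |a s i|) fun j => ∑ s, |b s j|
  have hA : ∀ x s k, |interp a b x s k| ≤ A k := by
    intro x s k
    rcases k with i | j
    · simp only [interp, Sum.elim_inl, abs_mul, A]
      refine le_trans ?_ (abs_le_sum_abs a s i)
      exact mul_le_of_le_one_left (abs_nonneg _) (Real.abs_sin_le_one x)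
    · simp only [interp, Sum.elim_inr, abs_mul, A]
      refine le_trans ?_ (abs_le_sum_abs b s j)
      exact mul_le_of_le_one_left (abs_nonneg _) (Real.abs_cos_le_one x)
  refine (hasDerivAt_integral_of_dominated_loc_of_deriv_le (s := Set.univ)
    (F' := fun x g => avg (energy (interp a b x) c g)
        (fun s => ∑ k, interp a b (x + Real.pi / 2) s k * g k))
    (bound := fun g => ∑ k, A k * |g k|) univ_mem ?_ ?_ ?_ ?_ ?_ ?_).2
  · exact Eventually.of_forall fun x =>
      (integrable_log_sumExp_energy (interp a b x) c).aestronglyMeasurable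
  · exact integrable_log_sumExp_energy _ c
  · have : ∀ g, avg (energy (interp a b θ) c g)
        (fun s => ∑ k, interp a b (θ + Real.pi / 2) s k * g k)
        = ∑ k, g k * avg (energy (interp a b θ) c g)
          (fun s => interp a b (θ + Real.pi / 2) s k) := by
      intro g
      rw [avg_sum]
      simp only [← avg_const_mul, mul_comm]
    simp only [this]
    exact (Finset.measurable_sum _ fun k _ =>
      (measurable_pi_apply k).mul (measurable_avg_energy _ c _)).aestronglyMeasurable
  · refine ae_of_all _ fun g x _ => abs_avg_le _ fun s => ?_
    refine (Finset.abs_sum_le_sum_abs _ _).trans (Finset.sum_le_sum fun k _ => ?_)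
    rw [abs_mul]
    exact mul_le_mul_of_nonneg_right (hA _ s k) (abs_nonneg _)
  · exact integrable_finsetSum _ fun k _ => (integrable_eval k).abs.const_mul _
  · exact ae_of_all _ fun g x _ => hasDerivAt_log_sumExp fun s => hd g x s

/-- Gaussian comparison for the free energy, in the manner of Sudakov and Fernique: larger
increments of the Gaussian energy give a larger expected free energy. -/
theorem integral_log_sumExp_mono (a : S → ι → ℝ) (b : S → κ → ℝ) (c : S → ℝ)
    (h : ∀ s s', ∑ j, (b s j - b s' j) ^ 2 ≤ ∑ i, (a s i - a s' i) ^ 2) :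
    ∫ g, Real.log (sumExp (energy b c g)) ∂gaussianPi κ
      ≤ ∫ g, Real.log (sumExp (energy a c g)) ∂gaussianPi ι := by
  let φ : ℝ → ℝ := fun θ =>
    ∫ g, Real.log (sumExp (energy (interp a b θ) c g)) ∂gaussianPi (ι ⊕ κ)
  have hφ := hasDerivAt_integral_interp a b c
  have hmono : MonotoneOn φ (Set.Icc 0 (Real.pi / 2)) := by
    refine monotoneOn_of_deriv_nonneg (convex_Icc _ _)
      (fun θ _ => (hφ θ).continuousAt.continuousWithinAt)
      (fun θ _ => (hφ θ).differentiableAt.differentiableWithinAt) fun θ hθ => ?_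
    rw [interior_Icc] at hθ
    rw [(hφ θ).deriv, integral_avg_sum_mul_eval]
    refine integral_nonneg fun g => ?_
    -- Symmetrized over two replicas, the integrand compares the increments of `a` and `b`.
    simp only [avg_mul_sub, ← Finset.mul_sum]
    refine mul_nonneg (by norm_num) ?_
    rw [Finset.sum_comm]
    refine Finset.sum_nonneg fun s _ => ?_
    rw [Finset.sum_comm]
    refine Finset.sum_nonneg fun s' _ => ?_
    rw [← Finset.mul_sum]
    refine mul_nonneg (mul_nonneg (prob_nonneg _ _) (prob_nonneg _ _)) ?_
    have hs : 0 ≤ Real.sin θ := Real.sin_nonneg_of_nonneg_of_le_pi hθ.1.le (by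
      linarith [hθ.2, Real.pi_pos])
    have hc : 0 ≤ Real.cos θ := Real.cos_nonneg_of_neg_pi_div_two_le_of_le (by
      linarith [hθ.1, Real.pi_pos]) hθ.2.le
    have : ∑ k, (interp a b (θ + Real.pi / 2) s k - interp a b (θ + Real.pi / 2) s' k)
          * (interp a b θ s k - interp a b θ s' k)
        = Real.sin θ * Real.cos θ
          * (∑ i, (a s i - a s' i) ^ 2 - ∑ j, (b s j - b s' j) ^ 2) := by
      rw [Fintype.sum_sum_type, mul_sub, Finset.mul_sum, Finset.mul_sum, sub_eq_add_neg,
        ← Finset.sum_neg_distrib]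
      simp only [interp, Sum.elim_inl, Sum.elim_inr, Real.sin_add_pi_div_two,
        Real.cos_add_pi_div_two]
      congr 1 <;> exact Finset.sum_congr rfl fun i _ => by ring
    rw [this]
    exact mul_nonneg (mul_nonneg hs hc) (sub_nonneg.2 (h s s'))
  have h0 : φ 0 = ∫ g, Real.log (sumExp (energy b c g)) ∂gaussianPi κ := by
    rw [← integral_log_sumExp_comp_inr (ι := ι)]
    have e : ∀ g : ι ⊕ κ → ℝ, energy (interp a b 0) c g = energy b c (g ∘ Sum.inr) := fun g => by
      ext s; simp [energy, interp]
    simp only [φ, e]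
  have h1 : φ (Real.pi / 2) = ∫ g, Real.log (sumExp (energy a c g)) ∂gaussianPi ι := by
    rw [← integral_log_sumExp_comp_inl (κ := κ)]
    have e : ∀ g : ι ⊕ κ → ℝ, energy (interp a b (Real.pi / 2)) c g
        = energy a c (g ∘ Sum.inl) := fun g => by
      ext s; simp [energy, interp]
    simp only [φ, e]
  rw [← h0, ← h1]
  have hp : (0 : ℝ) ≤ Real.pi / 2 := by positivity
  exact hmono ⟨le_rfl, hp⟩ ⟨hp, le_rfl⟩ hp

end comparison

/-! ### Existence and concentration of the free energy -/

lemma spin_sq {N : ℕ} (σ : Config N) (i : Fin N) : spin σ i ^ 2 = 1 := by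
  rcases Int.units_eq_one_or (σ i) with h | h <;> simp [spin, h]

lemma abs_spin {N : ℕ} (σ : Config N) (i : Fin N) : |spin σ i| = 1 := by
  rcases Int.units_eq_one_or (σ i) with h | h <;> simp [spin, h]

/-- The coefficients of the disorder in `negHamiltonian`. -/
noncomputable def coef (β γ : ℝ) {N : ℕ} (σ : Config N) : Pairs N ⊕ Fin N → ℝ :=
  Sum.elim (fun p => β / √(N : ℝ) * (spin σ p.1.1 * spin σ p.1.2)) fun i => γ * spin σ i

/-- The part of `negHamiltonian` that does not depend on the disorder. -/
noncomputable def meanField (h : ℝ) {N : ℕ} (σ : Config N) : ℝ := h * ∑ i, spin σ i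

lemma negHamiltonian_eq_energy (β γ h : ℝ) {N : ℕ} (g : Disorder N) :
    negHamiltonian β γ h g = energy (coef β γ) (meanField h) g := by
  ext σ
  have e1 : β / √(N : ℝ) * ∑ p : Pairs N, g (Sum.inl p) * spin σ p.1.1 * spin σ p.1.2
      = ∑ p : Pairs N, coef β γ σ (Sum.inl p) * g (Sum.inl p) := by
    rw [Finset.mul_sum]
    exact Finset.sum_congr rfl fun p _ => by simp only [coef, Sum.elim_inl]; ring
  have e2 : γ * ∑ i, g (Sum.inr i) * spin σ i
      = ∑ i, coef β γ σ (Sum.inr i) * g (Sum.inr i) := by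
    rw [Finset.mul_sum]
    exact Finset.sum_congr rfl fun i _ => by simp only [coef, Sum.elim_inr]; ring
  rw [negHamiltonian, energy, Fintype.sum_sum_type, e1, e2, meanField]
  ring

lemma partitionFunction_eq (β γ h : ℝ) {N : ℕ} (g : Disorder N) :
    partitionFunction β γ h g = sumExp (energy (coef β γ) (meanField h) g) := by
  rw [← negHamiltonian_eq_energy]; rfl

/-- The expected logarithm of the partition function. -/
noncomputable def meanLog (β γ h : ℝ) (N : ℕ) : ℝ :=
  ∫ g, Real.log (sumExp (energy (coef β γ) (meanField h) g)) ∂gaussianPi (Pairs N ⊕ Fin N)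

lemma meanFreeEnergy_eq (N : ℕ) (β γ h : ℝ) :
    meanFreeEnergy N β γ h = 1 / (N : ℝ) * meanLog β γ h N := by
  simp only [meanFreeEnergy, freeEnergy, partitionFunction_eq, meanLog]
  exact integral_const_mul _ _

/-- Twice the sum of a symmetric function over the pairs `i < j` is its off-diagonal sum. -/
lemma sum_pairs {N : ℕ} (f : Fin N → Fin N → ℝ) (hf : ∀ i j, f i j = f j i) :
    2 * ∑ p : Pairs N, f p.1.1 p.1.2 = (∑ i, ∑ j, f i j) - ∑ i, f i i := by
  have h1 : ∑ p : Pairs N, f p.1.1 p.1.2 = ∑ i, ∑ j, if i < j then f i j else 0 := by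
    rw [← Fintype.sum_prod_type', ← Finset.sum_filter]
    exact (Finset.sum_subtype _ (by simp) fun p : Fin N × Fin N => f p.1 p.2).symm
  have h2 : ∑ i, ∑ j, (if i < j then f i j else 0) = ∑ i, ∑ j, if j < i then f i j else 0 := by
    rw [Finset.sum_comm]
    simp only [hf]
  have h3 : ∑ i, f i i = ∑ i, ∑ j, if i = j then f i j else 0 := by simp
  rw [two_mul, h1]
  nth_rw 2 [h2]
  rw [h3, eq_sub_iff_add_eq]
  simp only [← Finset.sum_add_distrib]
  refine Finset.sum_congr rfl fun i _ => Finset.sum_congr rfl fun j _ => ?_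
  rcases lt_trichotomy i j with h | h | h
  · simp [h, h.ne, h.not_gt]
  · simp [h]
  · simp [h, h.ne', h.not_gt]

/-- The variance of the increment of the energy between `σ` and `τ`, in terms of their overlap. For
`N = 0` both sides vanish, with the convention `x / 0 = 0`. -/
lemma sum_coef_sub_sq (β γ : ℝ) {N : ℕ} (σ τ : Config N) :
    ∑ k, (coef β γ σ k - coef β γ τ k) ^ 2
      = β ^ 2 * (N - (∑ i, spin σ i * spin τ i) ^ 2 / N)
        + γ ^ 2 * ∑ i, (spin σ i - spin τ i) ^ 2 := by
  have h := sum_pairs (fun i j => (spin σ i * spin σ j - spin τ i * spin τ j) ^ 2)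
    fun i j => by rw [mul_comm (spin σ i), mul_comm (spin τ i)]
  have e1 : ∀ i j, (spin σ i * spin σ j - spin τ i * spin τ j) ^ 2
      = 2 - 2 * ((spin σ i * spin τ i) * (spin σ j * spin τ j)) := fun i j => by
    have a := spin_sq σ i
    have b := spin_sq σ j
    have c := spin_sq τ i
    have d := spin_sq τ j
    calc _ = spin σ i ^ 2 * spin σ j ^ 2 + spin τ i ^ 2 * spin τ j ^ 2
          - 2 * ((spin σ i * spin τ i) * (spin σ j * spin τ j)) := by ring
      _ = _ := by rw [a, b, c, d]; ring
  have e2 : ∀ i, (spin σ i * spin σ i - spin τ i * spin τ i) ^ 2 = 0 := fun i => by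
    rw [← sq, ← sq, spin_sq, spin_sq]; norm_num
  have e3 : ∑ p : Pairs N, (spin σ p.1.1 * spin σ p.1.2 - spin τ p.1.1 * spin τ p.1.2) ^ 2
      = (N : ℝ) ^ 2 - (∑ i, spin σ i * spin τ i) ^ 2 := by
    simp only [e2] at h
    have : ∑ i, ∑ j, (spin σ i * spin σ j - spin τ i * spin τ j) ^ 2
        = 2 * (N : ℝ) ^ 2 - 2 * (∑ i, spin σ i * spin τ i) ^ 2 := by
      simp only [e1, Finset.sum_sub_distrib, ← Finset.mul_sum, ← Finset.sum_mul]
      simp only [Finset.sum_const, Finset.card_univ, Fintype.card_fin, nsmul_eq_mul]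
      ring
    rw [this, Finset.sum_const_zero] at h
    linarith
  rw [Fintype.sum_sum_type]
  simp only [coef, Sum.elim_inl, Sum.elim_inr, ← mul_sub, mul_pow, ← Finset.mul_sum]
  rw [e3, div_pow, Real.sq_sqrt (Nat.cast_nonneg N)]
  rcases Nat.eq_zero_or_pos N with rfl | hN
  · simp
  · have : (N : ℝ) ≠ 0 := by positivity
    field_simp

/-- A uniform bound for the coefficients of the disorder. -/
noncomputable def coefBound (β γ : ℝ) (N : ℕ) : Pairs N ⊕ Fin N → ℝ :=
  Sum.elim (fun _ => |β| / √(N : ℝ)) fun _ => |γ|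

lemma abs_coef (β γ : ℝ) {N : ℕ} (σ : Config N) (k : Pairs N ⊕ Fin N) :
    |coef β γ σ k| = coefBound β γ N k := by
  rcases k with p | i
  · simp [coef, coefBound, abs_mul, abs_spin, abs_div, abs_of_nonneg (Real.sqrt_nonneg _)]
  · simp [coef, coefBound, abs_mul, abs_spin]

lemma sum_coefBound_sq_le (β γ : ℝ) (N : ℕ) :
    ∑ k, coefBound β γ N k ^ 2 ≤ N * (β ^ 2 + γ ^ 2) := by
  have hc : (Fintype.card (Pairs N) : ℝ) ≤ N * N := by
    have := Fintype.card_subtype_le fun p : Fin N × Fin N => p.1 < p.2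
    rw [Fintype.card_prod, Fintype.card_fin] at this
    exact_mod_cast this
  simp only [coefBound, Fintype.sum_sum_type, Sum.elim_inl, Sum.elim_inr, Finset.sum_const,
    Finset.card_univ, Fintype.card_fin, nsmul_eq_mul, sq_abs, div_pow,
    Real.sq_sqrt (Nat.cast_nonneg (α := ℝ) N), mul_add]
  refine add_le_add_left ?_ _
  rcases Nat.eq_zero_or_pos N with rfl | hN
  · simp
  · have hN' : (0 : ℝ) < N := by exact_mod_cast hN
    calc (Fintype.card (Pairs N) : ℝ) * (β ^ 2 / N) ≤ N * N * (β ^ 2 / N) := by gcongr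
      _ = N * β ^ 2 := by field_simp

section append

lemma spin_append_castAdd {M K : ℕ} (σ : Config M) (τ : Config K) (i : Fin M) :
    spin (Fin.append σ τ) (Fin.castAdd K i) = spin σ i := by simp [spin]

lemma spin_append_natAdd {M K : ℕ} (σ : Config M) (τ : Config K) (i : Fin K) :
    spin (Fin.append σ τ) (Fin.natAdd M i) = spin τ i := by simp [spin]

/-- Convexity of the square. If `m = 0` or `k = 0` the corresponding quotient is `0` by
convention. -/
lemma add_sq_div_add_le {x y : ℝ} {m k : ℕ} (hx : m = 0 → x = 0) (hy : k = 0 → y = 0) :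
    (x + y) ^ 2 / ((m + k : ℕ) : ℝ) ≤ x ^ 2 / m + y ^ 2 / k := by
  rcases Nat.eq_zero_or_pos m with rfl | hm
  · simp [hx rfl]
  rcases Nat.eq_zero_or_pos k with rfl | hk
  · simp [hy rfl]
  have hm' : (0 : ℝ) < m := by exact_mod_cast hm
  have hk' : (0 : ℝ) < k := by exact_mod_cast hk
  push_cast
  rw [div_add_div _ _ hm'.ne' hk'.ne', div_le_div_iff₀ (by positivity) (by positivity)]
  nlinarith [sq_nonneg (x * k - y * m)]

/-- The free energy of the Sherrington–Kirkpatrick model is superadditive in the system size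
(Guerra and Toninelli): the increments of the energy on `M + K` sites dominate those of two
independent systems on `M` and on `K` sites, by convexity of the square of the overlap. -/
lemma meanLog_add_le (β γ h : ℝ) (M K : ℕ) :
    meanLog β γ h M + meanLog β γ h K ≤ meanLog β γ h (M + K) := by
  let a : Config M × Config K → Pairs (M + K) ⊕ Fin (M + K) → ℝ := fun s =>
    coef β γ (Fin.append s.1 s.2)
  let b : Config M × Config K → (Pairs M ⊕ Fin M) ⊕ (Pairs K ⊕ Fin K) → ℝ := fun s =>
    Sum.elim (coef β γ s.1) (coef β γ s.2)
  let c : Config M × Config K → ℝ := fun s => meanField h s.1 + meanField h s.2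
  have hc : ∀ s, c s = meanField h (Fin.append s.1 s.2) := fun s => by
    simp only [c, meanField, Fin.sum_univ_add, spin_append_castAdd, spin_append_natAdd, mul_add]
  have hA : ∀ g, sumExp (energy a c g)
      = sumExp (energy (coef β γ) (meanField h) g) := fun g => by
    refine (Fin.appendEquiv M K).sum_comp
      (fun σ => Real.exp (energy (coef β γ) (meanField h) g σ)) |>.symm.trans ?_ |>.symm
    refine Finset.sum_congr rfl fun s _ => ?_
    simp only [energy, hc, a]
    rfl
  have hB : ∀ g, Real.log (sumExp (energy b c g))
      = Real.log (sumExp (energy (coef β γ) (meanField h) (g ∘ Sum.inl)))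
        + Real.log (sumExp (energy (coef β γ) (meanField h) (g ∘ Sum.inr))) := fun g => by
    rw [← Real.log_mul (sumExp_pos _).ne' (sumExp_pos _).ne']
    congr 1
    simp only [sumExp, Finset.sum_mul_sum, ← Real.exp_add]
    rw [Fintype.sum_prod_type]
    refine Finset.sum_congr rfl fun σ _ => Finset.sum_congr rfl fun τ _ => ?_
    congr 1
    simp only [energy, b, c, Fintype.sum_sum_type (α₁ := Pairs M ⊕ Fin M), Sum.elim_inl,
      Sum.elim_inr, Function.comp_apply]
    ring
  have key := integral_log_sumExp_mono a b c fun s s' => by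
    rw [Fintype.sum_sum_type (α₁ := Pairs M ⊕ Fin M)]
    simp only [a, b, Sum.elim_inl, Sum.elim_inr, sum_coef_sub_sq, Fin.sum_univ_add,
      spin_append_castAdd, spin_append_natAdd]
    have := add_sq_div_add_le (m := M) (k := K) (x := ∑ i, spin s.1 i * spin s'.1 i)
      (y := ∑ i, spin s.2 i * spin s'.2 i) (by rintro rfl; simp) (by rintro rfl; simp)
    have := mul_le_mul_of_nonneg_left this (sq_nonneg β)
    push_cast at this ⊢
    linarith
  simp only [hA, hB] at key
  have hI1 := measurePreserving_comp_inl (κ := Pairs K ⊕ Fin K)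
    |>.integrable_comp_of_integrable
      (integrable_log_sumExp_energy (coef β γ (N := M)) (meanField h))
  have hI2 := measurePreserving_comp_inr (ι := Pairs M ⊕ Fin M)
    |>.integrable_comp_of_integrable
      (integrable_log_sumExp_energy (coef β γ (N := K)) (meanField h))
  refine le_trans (le_of_eq ?_) key
  rw [meanLog, meanLog, ← integral_log_sumExp_comp_inl (κ := Pairs K ⊕ Fin K),
    ← integral_log_sumExp_comp_inr (ι := Pairs M ⊕ Fin M)]
  exact (integral_add hI1 hI2).symm

end append

section bound
variable {S ι : Type*} [Fintype S] [Nonempty S] [Fintype ι]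

lemma integrable_exp_sum_mul (a : ι → ℝ) :
    Integrable (fun g : ι → ℝ => Real.exp (∑ i, a i * g i)) (gaussianPi ι) := by
  simp only [Real.exp_sum]
  exact Integrable.fintype_prod fun i => integrable_exp_mul_gaussianReal (a i)

lemma integral_exp_sum_mul (a : ι → ℝ) :
    ∫ g : ι → ℝ, Real.exp (∑ i, a i * g i) ∂gaussianPi ι = Real.exp ((∑ i, a i ^ 2) / 2) := by
  simp only [Real.exp_sum, Finset.sum_div]
  rw [integral_fintype_prod_eq_prod (fun i x => Real.exp (a i * x))]
  refine Finset.prod_congr rfl fun i _ => ?_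
  have := congrFun (mgf_fun_id_gaussianReal (μ := 0) (v := 1)) (a i)
  simpa [mgf] using this

/-- The annealed bound for the expected free energy. -/
lemma integral_log_sumExp_le (a : S → ι → ℝ) (c : S → ℝ) {A C : ℝ}
    (hA : ∀ s, ∑ i, a s i ^ 2 ≤ A) (hC : ∀ s, c s ≤ C) :
    ∫ g, Real.log (sumExp (energy a c g)) ∂gaussianPi ι
      ≤ Real.log (Fintype.card S) + C + A / 2 := by
  -- `K` bounds the expected partition function, and `log Z ≤ Z / K - 1 + log K`.
  let K : ℝ := Fintype.card S * Real.exp (C + A / 2)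
  have hS : (0 : ℝ) < Fintype.card S := by exact_mod_cast Fintype.card_pos
  have hK : 0 < K := mul_pos hS (Real.exp_pos _)
  have hi : ∀ s, Integrable (fun g => Real.exp (energy a c g s)) (gaussianPi ι) := fun s => by
    simp only [energy, Real.exp_add]
    exact (integrable_exp_sum_mul _).const_mul _
  have hI : Integrable (fun g => sumExp (energy a c g)) (gaussianPi ι) :=
    integrable_finsetSum _ fun s _ => hi s
  have hZ : ∫ g, sumExp (energy a c g) ∂gaussianPi ι ≤ K := by
    simp only [sumExp]
    rw [integral_finsetSum _ fun s _ => hi s]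
    have : ∀ s ∈ Finset.univ, ∫ g, Real.exp (energy a c g s) ∂gaussianPi ι
        ≤ Real.exp (C + A / 2) := fun s _ => by
      simp only [energy, Real.exp_add (c s)]
      rw [integral_const_mul, integral_exp_sum_mul, ← Real.exp_add]
      exact Real.exp_le_exp.2 (add_le_add (hC s) (by linarith [hA s]))
    simpa [K] using Finset.sum_le_card_nsmul _ _ _ this
  have hlogK : Real.log K = Real.log (Fintype.card S) + C + A / 2 := by
    rw [Real.log_mul hS.ne' (Real.exp_pos _).ne', Real.log_exp, add_assoc]
  calc ∫ g, Real.log (sumExp (energy a c g)) ∂gaussianPi ι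
      ≤ ∫ g, (sumExp (energy a c g) / K - 1 + Real.log K) ∂gaussianPi ι := by
        refine integral_mono (integrable_log_sumExp_energy a c)
          (((hI.div_const K).sub (integrable_const 1)).add (integrable_const _)) fun g => ?_
        have := Real.log_le_sub_one_of_pos (div_pos (sumExp_pos (energy a c g)) hK)
        rw [Real.log_div (sumExp_pos _).ne' hK.ne'] at this
        linarith
    _ = (∫ g, sumExp (energy a c g) ∂gaussianPi ι) / K - 1 + Real.log K := by
        have h1 : Integrable (fun g => sumExp (energy a c g) / K - 1) (gaussianPi ι) :=
          (hI.div_const K).sub (integrable_const 1)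
        rw [integral_add h1 (integrable_const _),
          integral_sub (hI.div_const K) (integrable_const 1), integral_div]
        simp
    _ ≤ _ := by
        rw [hlogK]
        have : (∫ g, sumExp (energy a c g) ∂gaussianPi ι) / K ≤ 1 := (div_le_one hK).2 hZ
        linarith

end bound

lemma meanLog_le (β γ h : ℝ) (N : ℕ) :
    meanLog β γ h N ≤ N * (Real.log 2 + |h| + (β ^ 2 + γ ^ 2) / 2) := by
  have := integral_log_sumExp_le (coef β γ (N := N)) (meanField h)
    (A := N * (β ^ 2 + γ ^ 2)) (C := N * |h|)
    (fun σ => by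
      refine le_trans (Finset.sum_le_sum fun k _ => ?_) (sum_coefBound_sq_le β γ N)
      rw [← abs_coef β γ σ, sq_abs])
    (fun σ => by
      refine (le_abs_self _).trans ?_
      rw [meanField, abs_mul, mul_comm]
      refine mul_le_mul_of_nonneg_right ?_ (abs_nonneg h)
      refine (Finset.abs_sum_le_sum_abs _ _).trans ?_
      simp [abs_spin])
  refine this.trans_eq ?_
  have : Real.log (Fintype.card (Config N)) = N * Real.log 2 := by
    rw [Fintype.card_fun, Fintype.card_fin, Fintype.card_units_int]
    push_cast
    rw [Real.log_pow]
  rw [this]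
  ring

/-- The limiting free energy exists, by Fekete's lemma. -/
lemma exists_tendsto_meanFreeEnergy (β γ h : ℝ) :
    ∃ p : ℝ, Tendsto (fun N => meanFreeEnergy N β γ h) atTop (𝓝 p) := by
  have hsub : Subadditive fun N => -meanLog β γ h N := fun M K => by
    have := meanLog_add_le β γ h M K
    linarith
  refine ⟨-hsub.lim, ?_⟩
  have hb : BddBelow (Set.range fun N : ℕ => -meanLog β γ h N / N) := by
    refine ⟨-(Real.log 2 + |h| + (β ^ 2 + γ ^ 2) / 2), ?_⟩
    rintro _ ⟨N, rfl⟩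
    rcases Nat.eq_zero_or_pos N with rfl | hN
    · simp only [Nat.cast_zero, div_zero, Left.neg_nonpos_iff]
      have := Real.log_pos one_lt_two
      positivity
    · have hN' : (0 : ℝ) < N := by exact_mod_cast hN
      show _ ≤ -meanLog β γ h N / N
      rw [le_div_iff₀ hN']
      have := meanLog_le β γ h N
      linarith
  refine (hsub.tendsto_lim hb).neg.congr fun N => ?_
  rw [meanFreeEnergy_eq]
  ring

/-- The free energy concentrates around its mean. -/
lemma integral_abs_freeEnergy_sub_le (β γ h : ℝ) {N : ℕ} (hN : 0 < N) :
    ∫ g, |freeEnergy β γ h g - meanFreeEnergy N β γ h| ∂disorderLaw N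
      ≤ √((β ^ 2 + γ ^ 2) / N) := by
  have hN' : (0 : ℝ) < N := by exact_mod_cast hN
  have h2 : MemLp (fun g : Disorder N => freeEnergy β γ h g) 2 (disorderLaw N) := by
    simp only [freeEnergy, partitionFunction_eq]
    exact (memLp_log_sumExp_energy _ _).const_mul _
  have hvar : Var[fun g : Disorder N => freeEnergy β γ h g; disorderLaw N]
      ≤ (β ^ 2 + γ ^ 2) / N := by
    simp only [freeEnergy, partitionFunction_eq]
    rw [variance_const_mul]
    have h1 : Var[fun g => Real.log (sumExp (energy (coef β γ (N := N)) (meanField h) g));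
        disorderLaw N] ≤ N * (β ^ 2 + γ ^ 2) :=
      (variance_le_of_lipschitz fun g g' =>
        abs_log_sumExp_energy_sub_le (fun σ k => (abs_coef β γ σ k).le) g g').trans
        (sum_coefBound_sq_le β γ N)
    calc _ ≤ (1 / (N : ℝ)) ^ 2 * (N * (β ^ 2 + γ ^ 2)) := by gcongr
      _ = _ := by field_simp
  have : IsProbabilityMeasure (disorderLaw N) := by unfold disorderLaw; infer_instance
  have h3 : MemLp (fun g : Disorder N => |freeEnergy β γ h g - meanFreeEnergy N β γ h|) 2
      (disorderLaw N) := (h2.sub (memLp_const _)).norm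
  refine Real.le_sqrt_of_sq_le (le_trans ?_ hvar)
  rw [variance_eq_integral h2.aestronglyMeasurable.aemeasurable]
  have h4 := variance_nonneg (fun g : Disorder N => |freeEnergy β γ h g - meanFreeEnergy N β γ h|)
    (disorderLaw N)
  rw [variance_eq_sub h3] at h4
  simp only [Pi.pow_apply, sq_abs] at h4
  exact sub_nonneg.1 h4

/-! ### Concentration of the field energy -/

/-- The interaction per site with the random field, that is, the derivative of `negHamiltonian / N`
in `γ`. -/
noncomputable def fieldEnergy {N : ℕ} (g : Disorder N) (σ : Config N) : ℝ :=
  1 / (N : ℝ) * ∑ i, g (Sum.inr i) * spin σ i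

section deviation
variable {S : Type*} [Fintype S] [Nonempty S]

lemma avg_exp_mul_sub (E T : S → ℝ) (l d : ℝ) :
    avg E (fun s => Real.exp (l * (T s - d)))
      = Real.exp (Real.log (sumExp fun s => E s + l * T s) - Real.log (sumExp E) - l * d) := by
  have e : ∀ s, Real.exp (l * (T s - d)) = Real.exp (-(l * d)) * Real.exp (l * T s) := fun s => by
    rw [← Real.exp_add]; congr 1; ring
  simp only [e]
  rw [avg_const_mul, avg_exp, sub_eq_add_neg (_ - _), Real.exp_add, Real.exp_sub,
    Real.exp_log (sumExp_pos _), Real.exp_log (sumExp_pos _), mul_comm]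

lemma exp_avg_le (E F : S → ℝ) : Real.exp (avg E F) ≤ avg E fun s => Real.exp (F s) := by
  have := convexOn_exp.map_sum_le (t := Finset.univ) (w := prob E) (p := F)
    (fun s _ => prob_nonneg E s) (sum_prob E) fun _ _ => Set.mem_univ _
  simpa only [smul_eq_mul, avg, mul_comm] using this

/-- The mean deviation of an observable `T` from `d` is controlled by the increments of the free
energy when `± l * T` is added to the energy. This is the exponential Chebyshev argument in
integrated form. -/
lemma mul_avg_abs_sub_le (E T : S → ℝ) (d l : ℝ) :
    l * avg E (fun s => |T s - d|) ≤ Real.log 2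
      + (|Real.log (sumExp fun s => E s + l * T s) - Real.log (sumExp E) - l * d|
        + |Real.log (sumExp fun s => E s + -l * T s) - Real.log (sumExp E) - -l * d|) := by
  set A := Real.log (sumExp fun s => E s + l * T s) - Real.log (sumExp E) - l * d with hA
  set B := Real.log (sumExp fun s => E s + -l * T s) - Real.log (sumExp E) - -l * d with hB
  rw [← avg_const_mul, ← Real.exp_le_exp, Real.exp_add, Real.exp_log two_pos]
  calc Real.exp (avg E fun s => l * |T s - d|)
      ≤ avg E fun s => Real.exp (l * |T s - d|) := exp_avg_le E _
    _ ≤ avg E fun s => Real.exp (l * (T s - d)) + Real.exp (-l * (T s - d)) := by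
        refine avg_mono E fun s => ?_
        rcases abs_cases (T s - d) with ⟨h, _⟩ | ⟨h, _⟩ <;> rw [h]
        · linarith [Real.exp_pos (-l * (T s - d))]
        · rw [mul_neg, ← neg_mul]
          linarith [Real.exp_pos (l * (T s - d))]
    _ = Real.exp A + Real.exp B := by
        rw [avg_add, avg_exp_mul_sub, avg_exp_mul_sub]
    _ ≤ Real.exp (|A| + |B|) + Real.exp (|A| + |B|) := by
        refine add_le_add (Real.exp_le_exp.2 ?_) (Real.exp_le_exp.2 ?_)
        · linarith [le_abs_self A, abs_nonneg B]
        · linarith [le_abs_self B, abs_nonneg A]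
    _ = 2 * Real.exp (|A| + |B|) := by ring

end deviation

section concentration
variable (β γ h : ℝ)

instance (N : ℕ) : IsProbabilityMeasure (disorderLaw N) := by unfold disorderLaw; infer_instance

lemma measurable_prob_negHamiltonian {N : ℕ} (σ : Config N) :
    Measurable fun g : Disorder N => prob (negHamiltonian β γ h g) σ := by
  have h1 := measurable_sumExp_energy (coef β γ (N := N)) (meanField h)
  have h2 : Measurable fun g => Real.exp (energy (coef β γ (N := N)) (meanField h) g σ) := by
    unfold energy; fun_prop
  simp only [negHamiltonian_eq_energy]
  exact h2.div h1

lemma integrable_freeEnergy (N : ℕ) :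
    Integrable (fun g : Disorder N => freeEnergy β γ h g) (disorderLaw N) := by
  simp only [freeEnergy, partitionFunction_eq]
  exact (integrable_log_sumExp_energy _ _).const_mul _

lemma negHamiltonian_add {N : ℕ} (hN : 0 < N) (s : ℝ) (g : Disorder N) (σ : Config N) :
    negHamiltonian β (γ + s) h g σ
      = negHamiltonian β γ h g σ + N * s * fieldEnergy g σ := by
  have : (N : ℝ) ≠ 0 := by positivity
  simp only [negHamiltonian, fieldEnergy]
  field_simp
  ring

lemma abs_fieldEnergy_le {N : ℕ} (g : Disorder N) (σ : Config N) :
    |fieldEnergy g σ| ≤ 1 / (N : ℝ) * ∑ i, |g (Sum.inr i)| := by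
  rw [fieldEnergy, abs_mul, abs_of_nonneg (by positivity : (0 : ℝ) ≤ 1 / N)]
  refine mul_le_mul_of_nonneg_left ?_ (by positivity)
  refine (Finset.abs_sum_le_sum_abs _ _).trans_eq ?_
  simp [abs_mul, abs_spin]

/-- The mean absolute deviation of the field energy from the value `d`. -/
noncomputable def fieldDeviation (d : ℝ) (N : ℕ) : ℝ :=
  ∫ g : Disorder N, avg (negHamiltonian β γ h g) (fun σ => |fieldEnergy g σ - d|) ∂disorderLaw N

lemma integrable_avg_abs_fieldEnergy_sub (d : ℝ) (N : ℕ) :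
    Integrable (fun g : Disorder N =>
      avg (negHamiltonian β γ h g) fun σ => |fieldEnergy g σ - d|) (disorderLaw N) := by
  have hb : Integrable (fun g : Disorder N => 1 / (N : ℝ) * (∑ i, |g (Sum.inr i)|) + |d|)
      (disorderLaw N) :=
    ((integrable_finsetSum _ fun i _ => (integrable_eval (Sum.inr i)).abs).const_mul _).add
      (integrable_const _)
  refine hb.mono' ?_ (ae_of_all _ fun g => abs_avg_le _ fun σ => ?_)
  · refine (Finset.measurable_sum _ fun σ _ => Measurable.mul ?_
      (measurable_prob_negHamiltonian β γ h σ)).aestronglyMeasurable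
    unfold fieldEnergy
    fun_prop
  · rw [abs_abs]
    exact (abs_sub _ _).trans (add_le_add_left (abs_fieldEnergy_le g σ) _)

/-- The Gibbs average of the deviation of the field energy from `d` is small if the free energy, for
the given disorder, is close to affine with slope `d` between `γ - t` and `γ + t`. -/
lemma avg_abs_fieldEnergy_sub_le (d : ℝ) {t : ℝ} (ht : 0 < t) {N : ℕ} (hN : 0 < N)
    (g : Disorder N) :
    avg (negHamiltonian β γ h g) (fun σ => |fieldEnergy g σ - d|)
      ≤ Real.log 2 / (N * t)
        + (|freeEnergy β (γ + t) h g - freeEnergy β γ h g - t * d|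
          + |freeEnergy β (γ + -t) h g - freeEnergy β γ h g - -t * d|) / t := by
  have hN' : (0 : ℝ) < N := by exact_mod_cast hN
  have key := mul_avg_abs_sub_le (negHamiltonian β γ h g) (fieldEnergy g) d (N * t)
  have e : ∀ s, Real.log (sumExp fun σ => negHamiltonian β γ h g σ + N * s * fieldEnergy g σ)
      - Real.log (sumExp (negHamiltonian β γ h g)) - N * s * d
      = N * (freeEnergy β (γ + s) h g - freeEnergy β γ h g - s * d) := fun s => by
    have h1 : partitionFunction β (γ + s) h g
        = sumExp fun σ => negHamiltonian β γ h g σ + N * s * fieldEnergy g σ := by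
      simp only [← negHamiltonian_add β γ h hN]; rfl
    have h2 : partitionFunction β γ h g = sumExp (negHamiltonian β γ h g) := rfl
    rw [freeEnergy, freeEnergy, ← h1, ← h2]
    field_simp
  rw [← mul_neg, e, e, abs_mul, abs_mul, abs_of_pos hN', ← mul_add] at key
  have hNt : 0 < N * t := by positivity
  rw [← le_div_iff₀' hNt] at key
  refine key.trans_eq ?_
  field_simp

lemma integral_abs_freeEnergy_increment_le (d s : ℝ) {N : ℕ} (hN : 0 < N) :
    ∫ g : Disorder N, |freeEnergy β (γ + s) h g - freeEnergy β γ h g - s * d| ∂disorderLaw N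
      ≤ √((β ^ 2 + (γ + s) ^ 2) / N) + √((β ^ 2 + γ ^ 2) / N)
        + |meanFreeEnergy N β (γ + s) h - meanFreeEnergy N β γ h - s * d| := by
  have i0 : ∀ x, Integrable (fun g : Disorder N =>
      |freeEnergy β x h g - meanFreeEnergy N β x h|) (disorderLaw N) := fun x =>
    ((integrable_freeEnergy β x h N).sub (integrable_const _)).abs
  have i1 := i0 (γ + s)
  have i2 := i0 γ
  have i12 : Integrable (fun g : Disorder N =>
      |freeEnergy β (γ + s) h g - meanFreeEnergy N β (γ + s) h|
        + |freeEnergy β γ h g - meanFreeEnergy N β γ h|) (disorderLaw N) := i1.add i2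
  have i3 := integrable_const (μ := disorderLaw N)
    |meanFreeEnergy N β (γ + s) h - meanFreeEnergy N β γ h - s * d|
  calc _ ≤ ∫ g : Disorder N, (|freeEnergy β (γ + s) h g - meanFreeEnergy N β (γ + s) h|
        + |freeEnergy β γ h g - meanFreeEnergy N β γ h|
        + |meanFreeEnergy N β (γ + s) h - meanFreeEnergy N β γ h - s * d|) ∂disorderLaw N := by
        refine integral_mono_of_nonneg (ae_of_all _ fun _ => abs_nonneg _) (i12.add i3)
          (ae_of_all _ fun g => ?_)
        have e : freeEnergy β (γ + s) h g - freeEnergy β γ h g - s * d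
            = (freeEnergy β (γ + s) h g - meanFreeEnergy N β (γ + s) h)
              - (freeEnergy β γ h g - meanFreeEnergy N β γ h)
              + (meanFreeEnergy N β (γ + s) h - meanFreeEnergy N β γ h - s * d) := by ring
        simp only [e]
        exact (abs_add_le _ _).trans (add_le_add_left (abs_sub _ _) _)
    _ ≤ _ := by
        rw [integral_add i12 i3, integral_add i1 i2]
        refine add_le_add (add_le_add (integral_abs_freeEnergy_sub_le _ _ _ hN)
          (integral_abs_freeEnergy_sub_le _ _ _ hN)) ?_
        simp

lemma fieldDeviation_nonneg (d : ℝ) (N : ℕ) : 0 ≤ fieldDeviation β γ h d N :=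
  integral_nonneg fun _ => (avg_mono _ fun _ => abs_nonneg _).trans' (avg_const _ 0).ge

lemma fieldDeviation_le (d : ℝ) {t : ℝ} (ht : 0 < t) {N : ℕ} (hN : 0 < N) :
    fieldDeviation β γ h d N ≤ Real.log 2 / (N * t)
      + ((√((β ^ 2 + (γ + t) ^ 2) / N) + √((β ^ 2 + γ ^ 2) / N)
          + |meanFreeEnergy N β (γ + t) h - meanFreeEnergy N β γ h - t * d|)
        + (√((β ^ 2 + (γ + -t) ^ 2) / N) + √((β ^ 2 + γ ^ 2) / N)
          + |meanFreeEnergy N β (γ + -t) h - meanFreeEnergy N β γ h - -t * d|)) / t := by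
  have i : ∀ s, Integrable (fun g : Disorder N =>
      |freeEnergy β (γ + s) h g - freeEnergy β γ h g - s * d|) (disorderLaw N) := fun s =>
    (((integrable_freeEnergy β (γ + s) h N).sub (integrable_freeEnergy β γ h N)).sub
      (integrable_const (s * d))).abs
  have i2 : Integrable (fun g : Disorder N =>
      (|freeEnergy β (γ + t) h g - freeEnergy β γ h g - t * d|
        + |freeEnergy β (γ + -t) h g - freeEnergy β γ h g - -t * d|) / t) (disorderLaw N) :=
    ((i t).add (i (-t))).div_const t
  calc fieldDeviation β γ h d N
      ≤ ∫ g : Disorder N, (Real.log 2 / (N * t)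
        + (|freeEnergy β (γ + t) h g - freeEnergy β γ h g - t * d|
          + |freeEnergy β (γ + -t) h g - freeEnergy β γ h g - -t * d|) / t) ∂disorderLaw N :=
        integral_mono (integrable_avg_abs_fieldEnergy_sub β γ h d N)
          ((integrable_const _).add i2)
          fun g => avg_abs_fieldEnergy_sub_le β γ h d ht hN g
    _ ≤ _ := by
        rw [integral_add (integrable_const _) i2, integral_const, probReal_univ, one_smul,
          integral_div, integral_add (i t) (i (-t))]
        have h1 := integral_abs_freeEnergy_increment_le β γ h d t hN
        have h2 := integral_abs_freeEnergy_increment_le β γ h d (-t) hN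
        gcongr

/-- At a point of differentiability of the limiting free energy, the field energy concentrates
at the derivative, under the Gibbs measure and the disorder jointly. -/
lemma tendsto_fieldDeviation {p : ℝ → ℝ} {d : ℝ}
    (hp : ∀ x, Tendsto (fun N => meanFreeEnergy N β x h) atTop (𝓝 (p x)))
    (hd : HasDerivAt p d γ) :
    Tendsto (fun N => fieldDeviation β γ h d N) atTop (𝓝 0) := by
  rw [Metric.tendsto_atTop']
  intro ε hε
  -- The step `t` is fixed first, so that the error of the linear approximation of `p` at `γ ± t` is
  -- at most `ε t / 3`; then `N` tends to infinity.
  have ho := (hasDerivAt_iff_isLittleO_nhds_zero.1 hd).def (show 0 < ε / 3 by positivity)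
  obtain ⟨δ, hδ, hδ'⟩ := Metric.eventually_nhds_iff.1 ho
  set t := δ / 2 with ht_def
  have ht : 0 < t := by positivity
  have hsmall : ∀ s : ℝ, |s| = t → |p (γ + s) - p γ - s * d| ≤ ε / 3 * t := fun s hs => by
    have := hδ' (y := s) (by rw [Real.dist_eq, sub_zero, hs]; linarith)
    rwa [Real.norm_eq_abs, Real.norm_eq_abs, smul_eq_mul, hs] at this
  have hinv : Tendsto (fun N : ℕ => ((N : ℝ))⁻¹) atTop (𝓝 0) := tendsto_inv_atTop_nhds_zero_nat
  have hsq : ∀ C : ℝ, Tendsto (fun N : ℕ => √(C / N)) atTop (𝓝 0) := fun C => by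
    have : Tendsto (fun N : ℕ => C / (N : ℝ)) atTop (𝓝 0) := by
      simpa [div_eq_mul_inv] using hinv.const_mul C
    have h0 := (Real.continuous_sqrt.tendsto 0).comp this
    rwa [Real.sqrt_zero] at h0
  have hlog : Tendsto (fun N : ℕ => Real.log 2 / (N * t)) atTop (𝓝 0) := by
    have := hinv.const_mul (Real.log 2 / t)
    rw [mul_zero] at this
    refine this.congr fun N => ?_
    rw [div_mul_eq_div_div_swap, div_eq_mul_inv (_ / t)]
  have hterm : ∀ s : ℝ, Tendsto (fun N : ℕ =>
      √((β ^ 2 + (γ + s) ^ 2) / N) + √((β ^ 2 + γ ^ 2) / N)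
        + |meanFreeEnergy N β (γ + s) h - meanFreeEnergy N β γ h - s * d|) atTop
      (𝓝 (0 + 0 + |p (γ + s) - p γ - s * d|)) := fun s =>
    ((hsq _).add (hsq _)).add (((hp _).sub (hp _)).sub_const _).abs
  have hlim := hlog.add (((hterm t).add (hterm (-t))).div_const t)
  have hlt : 0 + (0 + 0 + |p (γ + t) - p γ - t * d|
      + (0 + 0 + |p (γ + -t) - p γ - -t * d|)) / t < ε := by
    have h1 := hsmall t (abs_of_pos ht)
    have h2 := hsmall (-t) (by rw [abs_neg, abs_of_pos ht])
    rw [zero_add, div_lt_iff₀ ht]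
    nlinarith
  obtain ⟨N₀, hN₀⟩ := eventually_atTop.1 (hlim.eventually (gt_mem_nhds hlt))
  refine ⟨N₀, fun N hN => ?_⟩
  rw [Real.dist_eq, sub_zero, abs_of_nonneg (fieldDeviation_nonneg β γ h d N)]
  exact (fieldDeviation_le β γ h d ht (by omega)).trans_lt (hN₀ N hN.le)

end concentration

/-! ### Replicas and the Ghirlanda–Guerra identities -/

section replicas
variable (β γ h : ℝ) {N n : ℕ}

/-- The coefficients of the disorder in the total energy of `n` replicas. -/
noncomputable def replicaCoef (s : Fin n → Config N) (k : Pairs N ⊕ Fin N) : ℝ :=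
  ∑ l, coef β γ (s l) k

/-- A system of `n` replicas is itself a Gibbs system, with the sum of the energies. -/
lemma gibbsAverage_eq_avg (g : Disorder N) (F : (Fin n → Config N) → ℝ) :
    gibbsAverage β γ h g F
      = avg (energy (replicaCoef β γ) (fun s => ∑ l, meanField h (s l)) g) F := by
  have hE : ∀ s : Fin n → Config N,
      energy (replicaCoef β γ) (fun s => ∑ l, meanField h (s l)) g s
        = ∑ l, negHamiltonian β γ h g (s l) := fun s => by
    simp only [negHamiltonian_eq_energy, energy, replicaCoef, Finset.sum_add_distrib,
      Finset.sum_mul]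
    rw [Finset.sum_comm]
  have hZ : sumExp (energy (replicaCoef β γ) (fun s : Fin n → Config N =>
      ∑ l, meanField h (s l)) g) = partitionFunction β γ h g ^ n := by
    rw [partitionFunction, Fintype.sum_pow]
    simp only [sumExp, hE, Real.exp_sum]
  refine Finset.sum_congr rfl fun s _ => ?_
  simp only [gibbsMass, prob, hZ, hE, Real.exp_sum, Finset.prod_div_distrib, Finset.prod_const,
    Finset.card_univ, Fintype.card_fin]

/-- Each replica has the Gibbs measure as its law. -/
lemma gibbsAverage_single (g : Disorder N) (l : Fin n) (G : Config N → ℝ) :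
    gibbsAverage β γ h g (fun s : Fin n → Config N => G (s l))
      = avg (negHamiltonian β γ h g) G := by
  have e : ∀ s : Fin n → Config N, G (s l) * ∏ m, gibbsMass β γ h g (s m)
      = ∏ m, (if m = l then G (s m) else 1) * gibbsMass β γ h g (s m) := fun s => by
    rw [Finset.prod_mul_distrib]
    simp
  simp only [gibbsAverage, e]
  have := Finset.prod_univ_sum (fun _ : Fin n => (Finset.univ : Finset (Config N)))
    fun m σ => (if m = l then G σ else 1) * gibbsMass β γ h g σ
  rw [Fintype.piFinset_univ] at this
  rw [← this, Fintype.prod_eq_single l]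
  · simp only [if_true]; rfl
  · intro m hm
    simp only [hm, if_false, one_mul]
    exact sum_prob (negHamiltonian β γ h g)

/-- The last of `n + 1` replicas is independent of the others given the disorder. -/
lemma gibbsAverage_last (g : Disorder N) (F : (Fin n → Config N) → ℝ) (G : Config N → ℝ) :
    gibbsAverage β γ h g (fun s : Fin (n + 1) → Config N =>
        F (fun l => s l.castSucc) * G (s (Fin.last n)))
      = gibbsAverage β γ h g F * avg (negHamiltonian β γ h g) G := by
  simp only [gibbsAverage]
  rw [← (Fin.snocEquiv fun _ : Fin (n + 1) => Config N).sum_comp, Fintype.sum_prod_type, avg,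
    Finset.sum_mul_sum, Finset.sum_comm]
  refine Finset.sum_congr rfl fun s _ => Finset.sum_congr rfl fun σ _ => ?_
  simp only [Fin.snocEquiv, Equiv.coe_fn_mk, Fin.snoc_castSucc, Fin.snoc_last,
    Fin.prod_univ_castSucc]
  simp only [gibbsMass, prob]
  change _ = _ * (_ * (_ / partitionFunction β γ h g))
  ring

lemma integrable_gibbsAverage (F : (Fin n → Config N) → ℝ) :
    Integrable (fun g => gibbsAverage β γ h g F) (disorderLaw N) := by
  simp only [gibbsAverage_eq_avg]
  exact integrable_avg_energy _ _ _

lemma abs_nu_le {F : (Fin n → Config N) → ℝ} {C : ℝ} (hF : ∀ s, |F s| ≤ C) :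
    |nu β γ h F| ≤ C := by
  have := norm_integral_le_of_norm_le_const (μ := disorderLaw N)
    (f := fun g => gibbsAverage β γ h g F) (C := C) (ae_of_all _ fun g => by
      rw [gibbsAverage_eq_avg]; exact abs_avg_le _ hF)
  simpa [nu] using this

lemma nu_sum {ι : Type*} (t : Finset ι) (F : ι → (Fin n → Config N) → ℝ) :
    nu β γ h (fun s => ∑ i ∈ t, F i s) = ∑ i ∈ t, nu β γ h (F i) := by
  simp only [nu]
  rw [← integral_finsetSum _ fun i _ => integrable_gibbsAverage β γ h _]
  simp only [gibbsAverage_eq_avg, avg_sum]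

lemma nu_const_mul (F : (Fin n → Config N) → ℝ) (r : ℝ) :
    nu β γ h (fun s => r * F s) = r * nu β γ h F := by
  simp only [nu, ← integral_const_mul, gibbsAverage_eq_avg, avg_const_mul]

/-- Gaussian integration by parts in the random field at the site `i`, for `n` replicas. -/
lemma integral_field_mul_gibbsAverage (F : (Fin n → Config N) → ℝ) (i : Fin N) :
    ∫ g, g (Sum.inr i) * gibbsAverage β γ h g F ∂disorderLaw N
      = γ * (∑ l, nu β γ h (fun s => F s * spin (s l) i)
        - n * nu β γ h (fun s : Fin (n + 1) → Config N =>
            F (fun l => s l.castSucc) * spin (s (Fin.last n)) i)) := by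
  have e1 : ∀ g, gibbsAverage β γ h g (fun s => F s * replicaCoef β γ s (Sum.inr i))
      = γ * ∑ l, gibbsAverage β γ h g fun s => F s * spin (s l) i := fun g => by
    simp only [gibbsAverage_eq_avg]
    rw [← avg_sum, ← avg_const_mul]
    congr 1
    ext s
    simp only [replicaCoef, coef, Sum.elim_inr, ← Finset.mul_sum]
    ring
  have e2 : ∀ g, gibbsAverage β γ h g (fun s : Fin n → Config N => replicaCoef β γ s (Sum.inr i))
      = γ * (n * avg (negHamiltonian β γ h g) fun σ => spin σ i) := fun g => by
    have : ∑ l : Fin n, gibbsAverage β γ h g (fun s : Fin n → Config N => spin (s l) i)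
        = n * avg (negHamiltonian β γ h g) fun σ => spin σ i := by
      simp [gibbsAverage_single β γ h g _ fun σ => spin σ i]
    rw [← this]
    simp only [gibbsAverage_eq_avg]
    rw [← avg_sum, ← avg_const_mul]
    congr 1
    ext s
    simp only [replicaCoef, coef, Sum.elim_inr, ← Finset.mul_sum]
  have key := integral_eval_mul_avg (replicaCoef β γ)
    (fun s : Fin n → Config N => ∑ l, meanField h (s l)) F (Sum.inr i)
  simp only [← gibbsAverage_eq_avg] at key
  refine key.trans ?_
  have e3 : ∀ g : Disorder N,
      gibbsAverage β γ h g (fun s => F s * replicaCoef β γ s (Sum.inr i))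
        - gibbsAverage β γ h g F
          * gibbsAverage β γ h g (fun s : Fin n → Config N => replicaCoef β γ s (Sum.inr i))
      = γ * (∑ l, gibbsAverage β γ h g (fun s => F s * spin (s l) i)
        - n * gibbsAverage β γ h g (fun s : Fin (n + 1) → Config N =>
            F (fun l => s l.castSucc) * spin (s (Fin.last n)) i)) := fun g => by
    rw [e1, e2, gibbsAverage_last β γ h g F fun σ => spin σ i]
    ring
  simp only [e3]
  rw [integral_const_mul]
  change γ * ∫ g, _ ∂disorderLaw N = _
  rw [integral_sub (integrable_finsetSum _ fun l _ => integrable_gibbsAverage β γ h _)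
    ((integrable_gibbsAverage β γ h _).const_mul _),
    integral_finsetSum _ fun l _ => integrable_gibbsAverage β γ h _, integral_const_mul]
  rfl

lemma overlap_self (hN : 0 < N) (σ : Config N) : overlap σ σ = 1 := by
  have : (N : ℝ) ≠ 0 := by positivity
  simp [overlap, ← sq, spin_sq, this]

lemma gibbsAverage_mul_fieldEnergy (l : Fin n) (f : (Fin n → Config N) → ℝ) (g : Disorder N) :
    gibbsAverage β γ h g (fun s => f s * fieldEnergy g (s l))
      = 1 / (N : ℝ) * ∑ i, g (Sum.inr i) * gibbsAverage β γ h g fun s => f s * spin (s l) i := by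
  simp only [gibbsAverage_eq_avg, ← avg_const_mul, ← avg_sum]
  congr 1
  ext s
  simp only [fieldEnergy, Finset.mul_sum]
  exact Finset.sum_congr rfl fun i _ => by ring

lemma integrable_field_mul_gibbsAverage (F : (Fin n → Config N) → ℝ) (i : Fin N) :
    Integrable (fun g => g (Sum.inr i) * gibbsAverage β γ h g F) (disorderLaw N) := by
  simp only [gibbsAverage_eq_avg]
  exact integrable_eval_mul_avg _ _ _ _

lemma integrable_gibbsAverage_mul_fieldEnergy (l : Fin n) (f : (Fin n → Config N) → ℝ) :
    Integrable (fun g => gibbsAverage β γ h g fun s => f s * fieldEnergy g (s l))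
      (disorderLaw N) := by
  simp only [gibbsAverage_mul_fieldEnergy]
  exact (integrable_finsetSum _ fun i _ =>
    integrable_field_mul_gibbsAverage β γ h _ i).const_mul _

/-- Gaussian integration by parts for the field energy of the first replica. -/
lemma integral_gibbsAverage_mul_fieldEnergy [NeZero n] (hN : 0 < N)
    (f : (Fin n → Config N) → ℝ) :
    ∫ g, gibbsAverage β γ h g (fun s => f s * fieldEnergy g (s 0)) ∂disorderLaw N
      = γ * (nu β γ h f + ∑ l ∈ Finset.Ioi (0 : Fin n),
            nu β γ h (fun s => overlap (s 0) (s l) * f s)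
          - n * nu β γ h (fun s : Fin (n + 1) → Config N =>
            overlap (s 0) (s (Fin.last n)) * f fun l => s l.castSucc)) := by
  have h1 : ∀ l : Fin n, nu β γ h (fun s => overlap (s 0) (s l) * f s)
      = 1 / (N : ℝ) * ∑ i, nu β γ h (fun s => f s * spin (s 0) i * spin (s l) i) := fun l => by
    rw [← nu_sum, ← nu_const_mul]
    congr 1
    ext s
    rw [overlap, mul_assoc, Finset.sum_mul]
    congr 1
    exact Finset.sum_congr rfl fun i _ => by ring
  have h2 : nu β γ h (fun s : Fin (n + 1) → Config N =>
        overlap (s 0) (s (Fin.last n)) * f fun l => s l.castSucc)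
      = 1 / (N : ℝ) * ∑ i, nu β γ h (fun s : Fin (n + 1) → Config N =>
        f (fun l => s l.castSucc) * spin (s (Fin.castSucc 0)) i * spin (s (Fin.last n)) i) := by
    rw [← nu_sum, ← nu_const_mul]
    congr 1
    ext s
    rw [overlap, mul_assoc, Finset.sum_mul]
    congr 1
    exact Finset.sum_congr rfl fun i _ => by rw [Fin.castSucc_zero']; ring
  -- The replica `0` contributes `ν(f)`, as its overlap with itself is `1`.
  have h0 : nu β γ h f + ∑ l ∈ Finset.Ioi (0 : Fin n),
      nu β γ h (fun s => overlap (s 0) (s l) * f s)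
      = ∑ l, nu β γ h (fun s => overlap (s 0) (s l) * f s) := by
    have hu : (Finset.univ : Finset (Fin n)) = insert 0 (Finset.Ioi 0) := by
      ext l
      simp
    rw [hu, Finset.sum_insert (by simp)]
    simp only [overlap_self hN, one_mul]
  simp only [gibbsAverage_mul_fieldEnergy]
  rw [integral_const_mul, integral_finsetSum _ fun i _ =>
    integrable_field_mul_gibbsAverage β γ h _ i]
  simp only [integral_field_mul_gibbsAverage]
  rw [h0, h2]
  simp only [h1]
  rw [← Finset.mul_sum, ← Finset.mul_sum, Finset.sum_sub_distrib, Finset.sum_comm,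
    ← Finset.mul_sum]
  ring

/-- Multiplying by the field energy amounts, up to its mean deviation from `d`, to multiplying
by `d`. -/
lemma abs_integral_mul_fieldEnergy_sub_le (d : ℝ) (l : Fin n) {f : (Fin n → Config N) → ℝ} {C : ℝ}
    (hf : ∀ s, |f s| ≤ C) :
    |∫ g, gibbsAverage β γ h g (fun s => f s * fieldEnergy g (s l)) ∂disorderLaw N
        - d * nu β γ h f| ≤ C * fieldDeviation β γ h d N := by
  rw [nu, ← integral_const_mul, ← integral_sub (integrable_gibbsAverage_mul_fieldEnergy β γ h l f)
    ((integrable_gibbsAverage β γ h f).const_mul d), fieldDeviation, ← integral_const_mul]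
  refine (abs_integral_le_integral_abs).trans ?_
  refine integral_mono_of_nonneg (ae_of_all _ fun _ => abs_nonneg _)
    ((integrable_avg_abs_fieldEnergy_sub β γ h d N).const_mul C) (ae_of_all _ fun g => ?_)
  simp only
  rw [← gibbsAverage_single β γ h g l fun σ => |fieldEnergy g σ - d|]
  simp only [gibbsAverage_eq_avg]
  rw [← avg_const_mul, ← avg_sub, ← avg_const_mul]
  refine (abs_avg_le_avg_abs _ _).trans (avg_mono _ fun s => ?_)
  rw [mul_comm d, ← mul_sub, abs_mul]
  exact mul_le_mul_of_nonneg_right (hf s) (abs_nonneg _)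

/-- The defect in the Ghirlanda–Guerra identity is controlled by the deviation of the field
energy. -/
lemma abs_delta_le [NeZero n] (hN : 0 < N) (d : ℝ) {f : (Pairs n → ℝ) → ℝ} {C : ℝ}
    (hf : ∀ x, |f x| ≤ C) :
    n * |γ| * |delta n f N β γ h| ≤ 2 * C * fieldDeviation β γ h d N := by
  have hn : (n : ℝ) ≠ 0 := by exact_mod_cast NeZero.ne n
  have h1 := integral_gibbsAverage_mul_fieldEnergy β γ h hN
    fun s : Fin n → Config N => f (overlaps s)
  -- With one replica and the constant `1`, this evaluates `ν(e)` as `γ (1 - ν(R₁₂))`.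
  have h2 := integral_gibbsAverage_mul_fieldEnergy β γ h hN fun _ : Fin 1 → Config N => 1
  have h3 := abs_integral_mul_fieldEnergy_sub_le β γ h d (0 : Fin n)
    (f := fun s : Fin n → Config N => f (overlaps s)) (C := C) fun s => hf _
  have h4 := abs_integral_mul_fieldEnergy_sub_le β γ h d (0 : Fin 1)
    (f := fun _ : Fin 1 → Config N => 1) (C := 1) fun s => by simp
  have h5 : nu β γ h (fun _ : Fin 1 → Config N => 1) = 1 := by
    simp [nu, gibbsAverage_eq_avg, avg_const]
  have h6 : |nu β γ h (fun s : Fin n → Config N => f (overlaps s))| ≤ C :=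
    abs_nu_le β γ h fun s => hf _
  have hI : Finset.Ioi (0 : Fin 1) = ∅ := by decide
  rw [h1] at h3
  rw [h2, h5, hI, Finset.sum_empty] at h4
  simp only [mul_one, Nat.cast_one, one_mul, add_zero] at h4
  set D := fieldDeviation β γ h d N
  set r := nu β γ h (fun s : Fin 2 → Config N => overlap (s 0) (s 1))
  set v := nu β γ h (fun s : Fin n → Config N => f (overlaps s))
  have h4' : |γ * (1 - r) - d| ≤ D := h4
  have h7 : |(γ * (1 - r) - d) * v| ≤ D * C := by
    rw [abs_mul]
    exact mul_le_mul h4' h6 (abs_nonneg _) ((abs_nonneg _).trans h4')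
  have hδ : n * γ * delta n f N β γ h = (γ * (1 - r) - d) * v
      - (γ * (v + ∑ l ∈ Finset.Ioi (0 : Fin n),
            nu β γ h (fun s : Fin n → Config N => overlap (s 0) (s l) * f (overlaps s))
          - n * nu β γ h (fun s : Fin (n + 1) → Config N =>
            overlap (s 0) (s (Fin.last n)) * f (overlaps fun l : Fin n => s l.castSucc)))
        - d * v) := by
    simp only [delta]
    field_simp
    ring
  calc n * |γ| * |delta n f N β γ h| = |n * γ * delta n f N β γ h| := by
        rw [abs_mul, abs_mul, Nat.abs_cast]
    _ ≤ D * C + C * D := by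
        rw [hδ]
        exact (abs_sub _ _).trans (add_le_add h7 h3)
    _ = 2 * C * D := by ring

end replicas

end SK

/-- The limit `p` of the mean free energy exists for all parameters, and wherever it is
differentiable in `γ` with `γ ≠ 0`, the Ghirlanda-Guerra identities hold, for every number `n ≥ 1`
of replicas and every bounded measurable `f : ℝ^{n(n-1)/2} → ℝ`. -/
theorem theorem1 :
    ∃ p : ℝ → ℝ → ℝ → ℝ,
      (∀ β γ h : ℝ, Tendsto (fun N : ℕ => SK.meanFreeEnergy N β γ h) atTop (𝓝 (p β γ h))) ∧
      ∀ β γ h : ℝ, γ ≠ 0 → DifferentiableAt ℝ (fun x : ℝ => p β x h) γ →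
        ∀ (n : ℕ) [NeZero n] (f : (SK.Pairs n → ℝ) → ℝ),
          Measurable f → (∃ C : ℝ, ∀ x, |f x| ≤ C) →
          Tendsto (fun N : ℕ => SK.delta n f N β γ h) atTop (𝓝 0) := by
  choose p hp using SK.exists_tendsto_meanFreeEnergy
  refine ⟨p, hp, fun β γ h hγ hd n _ f _ ⟨C, hC⟩ => ?_⟩
  have hdev := SK.tendsto_fieldDeviation β γ h (fun x => hp β x h) hd.hasDerivAt
  have hn : (0 : ℝ) < n := by exact_mod_cast Nat.pos_of_ne_zero (NeZero.ne n)
  have hpos : 0 < n * |γ| := mul_pos hn (abs_pos.2 hγ)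
  have hlim := (hdev.const_mul (2 * C)).div_const (n * |γ|)
  rw [mul_zero, zero_div] at hlim
  refine squeeze_zero_norm' ?_ hlim
  filter_upwards [eventually_gt_atTop 0] with N hN
  rw [Real.norm_eq_abs, le_div_iff₀' hpos]
  exact SK.abs_delta_le β γ h hN _ hC
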